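/- Let $K$ be a field of characteristic $0$ (for example $K=\mathbb{C}$, or $K=\mathbb{C}(P,Q)$ with $P,Q$ indeterminates), and let $P,Q\in K$ be nonzero. **Operators.** For functions of integer variables with values in $K$ let $E_x p(x)=p(x+1)$, $\Delta_x=E_x-\mathrm{id}$, ${}_P\Delta_x=P^{-x}\Delta_x$, ${}_PE_x={}_P\Delta_x+\mathrm{id}$, ${}_P^QE_x=Q\,\mathrm{id}+{}_P\Delta_x$ and ${}_P^Q\mathrm{id}_x=Q\,{}_PE_x-{}_P\Delta_x$. For $i<0$ put ${}_PE_x^{\,i}=\bigl(\sum_{j\ge 0}(-1)^j\,{}_P\Delta_x^{\,j}\bigr)^{-i}$, which is applied to functions annihilated by a power of ${}_P\Delta_x$. Let $\binom{x}{m}_P=\prod_{i=0}^{m-1}\frac{1-P^{x-i}}{1-P^{i+1}}$ be the $P$-binomial coefficient for $x\in\mathbb{Z}$, $m\ge 0$; it is a Laurent polynomial in $P$, and it is evaluated as such where the quotient is undefined (so it is the ordinary binomial coefficient $\binom{x}{m}$ for $P=1$). Sums over integers obey $\sum_{x=a}^{b}g(x)=-\sum_{x=b+1}^{a-1}g(x)$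 for $a>b$. **Recursion.** Let $S\subseteq\mathbb{Z}^2$ be finite and $f:S\to K$ (in particular $f:S\to\mathbb{C}$ if $\mathbb{C}\subseteq K$). The summation operator is defined by $\sum_{(l_1,\ldots,l_{n-1})}^{(k_1,\ldots,k_n)}A=0$ for $n=0$, $\sum_{(-)}^{(k_1)}A=A$ for $n=1$, and for $n\ge 2$ $$\sum_{(l_1,\ldots,l_{n-1})}^{(k_1,\ldots,k_n)}A(l_1,\ldots,l_{n-1})=\Bigl(Q^{-1}\,{}_P^QE_{k_n}\,{}_P^Q\mathrm{id}_{k^*_{n-1}}\sum_{l_{n-1}=k^*_{n-1}}^{k_n-1}P^{l_{n-1}}\sum_{(l_1,\ldots,l_{n-2})}^{(k_1,\ldots,k_{n-1})}A(l_1,\ldots,l_{n-1})$$ $$+\sum_{(l_1,\ldots,l_{n-3})}^{(k_1,\ldots,k_{n-2})}\ \sum_{(i,j)\in S}f(i,j)\,{}_PE_{k_{n-1}}^{\,i}\,{}_PE_{k^*_{n-1}}^{\,j}A(l_1,\ldots,l_{n-3},k_{n-1},k^*_{n-1})\Bigr)\Big|_{k^*_{n-1}=k_{n-1}}.$$ For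 $m\ge 0$ put $\alpha_{P,Q}(1,m,S,f;k_1)=\binom{k_1}{m}_P$ and, for $n\ge 2$, $$\alpha_{P,Q}(n,m,S,f;k_1,\ldots,k_n)=\sum_{(l_1,\ldots,l_{n-1})}^{(k_1,\ldots,k_n)}\alpha_{P,Q}(n-1,m,S,f;l_1,\ldots,l_{n-1}).$$ **Theorem.** Let $n\ge 1$ and $m\ge 0$ be integers, $S\subseteq\mathbb{Z}^2$ finite and $f:S\to K$. Then $\alpha_{P,Q}(n,m,S,f;\cdot)$ is well defined: in each variable it is annihilated by a power of the corresponding ${}_P\Delta$. With $$V_{s,t}={}_P^QE_{k_t}\;{}_P^Q\mathrm{id}_{k_s}-{}_P\Delta_{k_s}\,{}_P\Delta_{k_t}\sum_{(i,j)\in S}f(i,j)\,{}_PE_{k_t}^{\,i}\,{}_PE_{k_s}^{\,j}$$ and with the products of operators below taken as compositions in any order, the following hold for all $(k_1,\ldots,k_n)\in\mathbb{Z}^n$. 1. $$\alpha_{P,Q}(n,m,S,f;k_1,\ldots,k_n)=P^{\frac16(n-1)(n^2-2n+6m)}\,Q^{-\binom n2}\prod_{1\le s<t\le n}V_{s,t}\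 \det_{1\le i,j\le n}\binom{k_i}{j-1+\delta_{j,n}m}_P .$$ 2. For $m=0$, if $P^d\ne 1$ for $1\le d<n$, $$\alpha_{P,Q}(n,0,S,f;k_1,\ldots,k_n)=P^{\binom{n+1}{3}}\,Q^{-\binom n2}\prod_{1\le s<t\le n}V_{s,t}\ \prod_{1\le i<j\le n}\frac{P^{k_j}-P^{k_i}}{P^j-P^i};$$ for $P=1$ the same holds with the last product replaced by its limit $\prod_{1\le i<j\le n}\frac{k_j-k_i}{j-i}$. 3. In particular, for $P=Q=1$, $m=0$, $S=\{(0,0)\}$, $f(0,0)=-1$, $$\alpha_{1,1}(n,0,\{(0,0)\},-1;k_1,\ldots,k_n)=\prod_{1\le s<t\le n}\bigl(\mathrm{id}-E_{k_s}+E_{k_s}E_{k_t}\bigr)\prod_{1\le i<j\le n}\frac{k_j-k_i}{j-i},$$ and for $k_1<k_2<\cdots<k_n$ this is the number of monotone triangles with bottom row $(k_1,\ldots,k_n)$, i.e. of integer arrays $(a_{i,j})_{1\le i\le j\le n}$ with $a_{1,j}=k_j$, $a_{i,j}\le a_{i+1,j+1}$ for $1\le i\le j<n$, $a_{i,j}\le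 a_{i-1,j}$ for $1<i\le j\le n$, and $a_{i,j}<a_{i,j+1}$ for $1\le i\le j\le n-1$. -/

import Mathlib

noncomputable section

namespace OperatorFormula

variable {K : Type*} [Field K]

/-- The sum `∑_{x=a}^{b} g x` over integers, with the convention
`∑_{x=a}^{b} g x = - ∑_{x=b+1}^{a-1} g x` for `a > b`. -/
def signedSum (a b : ℤ) (g : ℤ → K) : K :=
  if a ≤ b then ∑ x ∈ Finset.Icc a b, g x else -∑ x ∈ Finset.Icc (b + 1) (a - 1), g x

theorem signedSum_telescope (g G : ℤ → K) (h0 : G 0 = 0) (h : ∀ x, G (x + 1) = G x + g x)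
    (x : ℤ) : signedSum 0 (x - 1) g = G x := by
  have pos : ∀ n : ℕ, ∑ y ∈ Finset.Icc (0 : ℤ) ((n : ℤ) - 1), g y = G n := by
    intro n
    induction n with
    | zero => simp [h0]
    | succ n ih =>
      have e : Finset.Icc (0 : ℤ) (((n + 1 : ℕ) : ℤ) - 1)
          = insert (n : ℤ) (Finset.Icc (0 : ℤ) ((n : ℤ) - 1)) := by
        ext y; simp only [Finset.mem_Icc, Finset.mem_insert]; push_cast; omega
      rw [e, Finset.sum_insert (by simp), ih]
      push_cast
      rw [h]; ring
  have neg : ∀ n : ℕ, ∑ y ∈ Finset.Icc (-(n : ℤ)) (-1), g y = -G (-(n : ℤ)) := by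
    intro n
    induction n with
    | zero => simp [h0]
    | succ n ih =>
      have e : Finset.Icc (-((n + 1 : ℕ) : ℤ)) (-1)
          = insert (-((n + 1 : ℕ) : ℤ)) (Finset.Icc (-(n : ℤ)) (-1)) := by
        ext y; simp only [Finset.mem_Icc, Finset.mem_insert]; push_cast; omega
      have hs := h (-((n + 1 : ℕ) : ℤ))
      have e2 : -((n + 1 : ℕ) : ℤ) + 1 = -(n : ℤ) := by push_cast; ring
      rw [e2] at hs
      rw [e, Finset.sum_insert (by simp), ih, hs]
      ring
  unfold signedSum
  split_ifs with hx
  · obtain ⟨n, rfl⟩ := Int.eq_ofNat_of_zero_le (show 0 ≤ x by omega)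
    exact pos n
  · obtain ⟨n, hn⟩ := Int.eq_ofNat_of_zero_le (show 0 ≤ -x by omega)
    obtain rfl : x = -(n : ℤ) := by omega
    have := neg n
    simp only [sub_add_cancel, zero_sub]
    rw [this, neg_neg]

/-- The `P`-binomial coefficient `[x choose m]_P` for `x : ℤ`. It is a Laurent polynomial in `P`,
and is defined here, for every nonzero `P`, by the `P`-Pascal recursion
`[x+1 choose m+1] - [x choose m+1] = P^(x-m) [x choose m]`, `[0 choose m+1] = 0`.
It is the usual quotient wherever the latter is defined (`pBinom_eq_div`), and it is the ordinary
binomial coefficient, the limit of the quotient, for `P = 1` (`pBinom_one`). -/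
def pBinom (P : K) (x : ℤ) : ℕ → K
  | 0 => 1
  | m + 1 => signedSum 0 (x - 1) fun l => P ^ (l - (m : ℤ)) * pBinom P l m

theorem pBinom_eq_div (P : K) (hP : P ≠ 0) (m : ℕ) (hm : ∀ d : ℕ, 0 < d → d ≤ m → P ^ d ≠ 1)
    (x : ℤ) : pBinom P x m
      = (∏ i ∈ Finset.range m, (1 - P ^ (x - i))) / ∏ i ∈ Finset.range m, (1 - P ^ (i + 1)) := by
  induction m generalizing x with
  | zero => simp [pBinom]
  | succ m ih =>
    have ih' := ih (fun d h1 h2 => hm d h1 (by omega))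
    rw [pBinom]
    refine signedSum_telescope _ (fun x => (∏ i ∈ Finset.range (m + 1), (1 - P ^ (x - (i : ℤ)))) /
      ∏ i ∈ Finset.range (m + 1), (1 - P ^ (i + 1))) ?_ ?_ x
    · simp [Finset.prod_range_succ']
    · intro y
      rw [ih' y]
      have hd : ∏ i ∈ Finset.range m, (1 - P ^ (i + 1)) ≠ 0 := by
        refine Finset.prod_ne_zero_iff.2 fun i hi => ?_
        rw [Finset.mem_range] at hi
        exact sub_ne_zero.2 (hm (i + 1) (by omega) (by omega)).symm
      have hd1 : (1 : K) - P ^ (m + 1) ≠ 0 := sub_ne_zero.2 (hm (m + 1) (by omega) le_rfl).symm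
      have e1 : ∏ i ∈ Finset.range (m + 1), (1 - P ^ (y + 1 - (i : ℤ)))
          = (∏ i ∈ Finset.range m, (1 - P ^ (y - (i : ℤ)))) * (1 - P ^ (y + 1)) := by
        rw [Finset.prod_range_succ']
        congr 1
        · refine Finset.prod_congr rfl fun i _ => ?_
          congr 2; push_cast; ring
        · simp
      have e2 : (P : K) ^ (y + 1) = P ^ (y - (m : ℤ)) * P ^ (m + 1) := by
        rw [← zpow_natCast, ← zpow_add₀ hP]
        congr 1; push_cast; ring
      rw [e1, Finset.prod_range_succ, Finset.prod_range_succ, e2]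
      field_simp
      ring

theorem pBinom_one (x : ℤ) (m : ℕ) : pBinom (1 : K) x m = ((Ring.choose x m : ℤ) : K) := by
  induction m generalizing x with
  | zero => simp [pBinom]
  | succ m ih =>
    rw [pBinom]
    refine signedSum_telescope _ (fun x => ((Ring.choose x (m + 1) : ℤ) : K)) ?_ ?_ x
    · simp [Ring.choose_zero_succ]
    · intro y
      rw [ih y, Ring.choose_succ_succ]
      push_cast
      simp [add_comm]

section Operators

variable {ι : Type*} [DecidableEq ι]

/-- The shift operator `E_{k_s}`. -/
def shift (s : ι) (F : (ι → ℤ) → K) : (ι → ℤ) → K :=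
  fun k => F (Function.update k s (k s + 1))

/-- The `P`-difference operator `P^{-k_s} (E_{k_s} - id)`. -/
def pDelta (P : K) (s : ι) (F : (ι → ℤ) → K) : (ι → ℤ) → K :=
  fun k => P ^ (-k s) * (shift s F k - F k)

/-- The `P`-shift operator. -/
def pShift (P : K) (s : ι) (F : (ι → ℤ) → K) : (ι → ℤ) → K :=
  pDelta P s F + F

/-- The inverse `P`-shift operator `∑_{j ≥ 0} (-1)^j Δ^j`, where `Δ` is the `P`-difference operator
in the variable `k_s`. It is meant for functions that are annihilated by a power of `Δ`, for which
the sum is finite. -/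
def pShiftInv (P : K) (s : ι) (F : (ι → ℤ) → K) : (ι → ℤ) → K :=
  fun k => ∑ᶠ j : ℕ, (-1) ^ j * ((pDelta P s)^[j] F) k

/-- The integer powers of the `P`-shift operator. -/
def pShiftPow (P : K) (s : ι) : ℤ → ((ι → ℤ) → K) → (ι → ℤ) → K
  | Int.ofNat i => (pShift P s)^[i]
  | Int.negSucc i => (pShiftInv P s)^[i + 1]

/-- The `PQ`-shift operator `Q id + Δ`. -/
def pqShift (P Q : K) (s : ι) (F : (ι → ℤ) → K) : (ι → ℤ) → K :=
  Q • F + pDelta P s F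

/-- The `PQ`-identity: `Q` times the `P`-shift operator, minus the `P`-difference operator. -/
def pqId (P Q : K) (s : ι) (F : (ι → ℤ) → K) : (ι → ℤ) → K :=
  Q • pShift P s F - pDelta P s F

/-- The operator `∑_{(i,j) ∈ S} f(i,j) E_{k_x}^i E_{k_y}^j`, where `E` is the `P`-shift. -/
def laurentOp (P : K) (S : Finset (ℤ × ℤ)) (f : S → K) (x y : ι) (F : (ι → ℤ) → K) :
    (ι → ℤ) → K :=
  ∑ p : S, f p • pShiftPow P x p.1.1 (pShiftPow P y p.1.2 F)

/-- The factor belonging to the pair `s < t` in the operator formula. -/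
def factorOp (P Q : K) (S : Finset (ℤ × ℤ)) (f : S → K) (s t : ι) (F : (ι → ℤ) → K) :
    (ι → ℤ) → K :=
  pqShift P Q t (pqId P Q s F) - pDelta P s (pDelta P t (laurentOp P S f t s F))

/-- The composition of the operators `T s t`, for `(s, t)` in the list `L`, applied to `F`. -/
def opProd (T : ι → ι → ((ι → ℤ) → K) → (ι → ℤ) → K) (L : List (ι × ι)) (F : (ι → ℤ) → K) :
    (ι → ℤ) → K :=
  L.foldr (fun p G => T p.1 p.2 G) F

end Operators

/-- The first term of the summation operator: with `a = k_n` and `b = k*_{n-1}` as the two variables,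
`Q⁻¹` times the `PQ`-shift in `a` and the `PQ`-identity in `b` applied to
`∑_{l=b}^{a-1} P^l G(l)`. -/
def mainTerm (P Q : K) (G : ℤ → K) (a b : ℤ) : K :=
  Q⁻¹ * pqShift P Q (0 : Fin 2) (pqId P Q (1 : Fin 2)
    fun z => signedSum (z 1) (z 0 - 1) fun l => P ^ l * G l) ![a, b]

/-- The summation operator associated to `(S, f)`; `sumOp P Q S f n A k` is the sum with lower index
`(l_1, …, l_n)` and upper index `k = (k_1, …, k_{n+1})`. For `n = 1` the second term of the
recursion is the summation operator for an empty upper index, which is zero by convention. -/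
def sumOp (P Q : K) (S : Finset (ℤ × ℤ)) (f : S → K) :
    (n : ℕ) → ((Fin n → ℤ) → K) → (Fin (n + 1) → ℤ) → K
  | 0, A, _ => A ![]
  | 1, A, k => mainTerm P Q
      (fun x => sumOp P Q S f 0 (fun l => A (Fin.snoc (α := fun _ => ℤ) l x)) (Fin.init k))
      (k 1) (k 0)
  | n + 2, A, k =>
      mainTerm P Q
        (fun x => sumOp P Q S f (n + 1) (fun l => A (Fin.snoc (α := fun _ => ℤ) l x)) (Fin.init k))
        (k (Fin.last (n + 2))) (k (Fin.last (n + 1)).castSucc)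
      + sumOp P Q S f n
        (fun l => laurentOp P S f (0 : Fin 2) (1 : Fin 2)
          (fun z => A (Fin.snoc (α := fun _ => ℤ) (Fin.snoc (α := fun _ => ℤ) l (z 0)) (z 1)))
          ![k (Fin.last (n + 1)).castSucc, k (Fin.last (n + 1)).castSucc])
        (Fin.init (Fin.init k))

/-- The function `α_{P,Q}(n, m, S, f; k_1, …, k_n)`, for `n ≥ 1` (the value at `n = 0` is a
placeholder). -/
def alpha (P Q : K) (m : ℕ) (S : Finset (ℤ × ℤ)) (f : S → K) : (n : ℕ) → (Fin n → ℤ) → K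
  | 0 => fun _ => 0
  | 1 => fun k => pBinom P (k 0) m
  | n + 2 => sumOp P Q S f (n + 1) (alpha P Q m S f (n + 1))

/-- `det_{1 ≤ i, j ≤ n} [k_i choose j - 1 + δ_{j,n} m]_P`. -/
def binomDet (P : K) (n m : ℕ) (k : Fin n → ℤ) : K :=
  Matrix.det (Matrix.of fun i j : Fin n =>
    pBinom P (k i) ((j : ℕ) + if (j : ℕ) + 1 = n then m else 0))

/-- `∏_{1 ≤ i < j ≤ n} (P^{k_j} - P^{k_i}) / (P^j - P^i)`. -/
def pVandermonde (P : K) (n : ℕ) (k : Fin n → ℤ) : K :=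
  ∏ i : Fin n, ∏ j ∈ Finset.Ioi i,
    (P ^ k j - P ^ k i) / (P ^ ((j : ℕ) + 1) - P ^ ((i : ℕ) + 1))

/-- `∏_{1 ≤ i < j ≤ n} (k_j - k_i) / (j - i)`, the limit of `pVandermonde P n k` as `P → 1`. -/
def vandermonde (K : Type*) [Field K] (n : ℕ) (k : Fin n → ℤ) : K :=
  ∏ i : Fin n, ∏ j ∈ Finset.Ioi i, ((k j : K) - (k i : K)) / ((j : K) - (i : K))

/-- `a = (a_{i,j})_{1 ≤ i ≤ j ≤ n}` is a monotone triangle with bottom row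
`(a_{1,1}, …, a_{1,n}) = k`. (Indices start at `0` here.) -/
structure IsMonotoneTriangle {n : ℕ} (k : Fin n → ℤ)
    (a : {p : Fin n × Fin n // p.1 ≤ p.2} → ℤ) : Prop where
  northeast : ∀ p q, (q.1.1 : ℕ) = p.1.1 + 1 → (q.1.2 : ℕ) = p.1.2 + 1 → a p ≤ a q
  southeast : ∀ p q, (p.1.1 : ℕ) = q.1.1 + 1 → q.1.2 = p.1.2 → a p ≤ a q
  strict : ∀ p q, q.1.1 = p.1.1 → (q.1.2 : ℕ) = p.1.2 + 1 → a p < a q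
  bottom : ∀ p, (p.1.1 : ℕ) = 0 → a p = k p.1.2

end OperatorFormula

end

/-
The operators in the theorem are polynomials in the commuting `P`-differences `Δ_s` in the
variables `k_s`: on functions annihilated by `Δ_s ^ R` even the negative powers of the `P`-shift
are truncated geometric series. So polynomials act on functions, and `alpha P Q m S f n` is to be
identified, up to a constant, with `W_n D_n`, where `W_n` is the product of the polynomials
`V_{s,t}`, `s < t`, and `D_n` the determinant of `P`-binomial coefficients.

Up to a constant, `D_n` is `Δ_1 ⋯ Δ_n F` for a determinant `F` of the same kind, and `D_{n+1}` is
the alternating sum over `r` of the functions `F (k_1, …, k_{r-1}, k_{r+1}, …, k_{n+1})`, by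
expansion along a column of ones. On functions independent of `k_r`, the difference `Δ_r`
vanishes, so that the factors `V_{s,r}` and `V_{r,t}` of `W_{n+1}` degenerate, up to a factor `Q`,
to `idFactor` in the variables before `k_r` and to `shiftFactor` in those after it. It remains to
see that the summation operator takes `Δ_1 ⋯ Δ_n W_n F` to the alternating sum of the functions
`W_n F`, modified by these operators.

By induction on the number of variables, the inner sum is such an alternating sum, and the outer
one telescopes. This leaves an excess term in which two adjacent variables `k_i`, `k_{i+1}` agree,
and the second term of the recursion cancels it if `V_{i+1,i} W_n F` vanishes for `k_i = k_{i+1}`.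
It does: `V_{i,i+1}` is a factor of `W_n`, so that `V_{i+1,i} W_n` is symmetric in the two
variables while `F` is antisymmetric.
-/

noncomputable section

namespace OperatorFormula

variable {K : Type*} [Field K]

open MvPolynomial

section Action

variable {ι κ : Type*} [DecidableEq ι] [DecidableEq κ]

theorem pDelta_comm (P : K) (s t : ι) (F : (ι → ℤ) → K) :
    pDelta P s (pDelta P t F) = pDelta P t (pDelta P s F) := by
  rcases eq_or_ne s t with rfl | h
  · rfl
  · ext k
    simp only [pDelta, shift, Function.update_of_ne h, Function.update_of_ne h.symm,
      Function.update_comm h]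
    ring

/-- The `P`-difference operator in the variable `s`, as an element of the algebra of linear
operators on functions of integer variables. -/
def pDeltaLin (P : K) (s : ι) : Module.End K ((ι → ℤ) → K) where
  toFun := pDelta P s
  map_add' F G := by ext k; simp only [pDelta, shift, Pi.add_apply]; ring
  map_smul' c F := by
    ext k; simp only [pDelta, shift, Pi.smul_apply, smul_eq_mul, RingHom.id_apply]; ring

/-- The algebra generated by the `P`-difference operators. -/
abbrev pDeltaAlgebra (ι : Type*) [DecidableEq ι] (P : K) :
    Subalgebra K (Module.End K ((ι → ℤ) → K)) :=
  Algebra.adjoin K (Set.range (pDeltaLin P))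

open scoped IsMulCommutative in
instance (P : K) : CommRing (pDeltaAlgebra ι P) :=
  have : IsMulCommutative (pDeltaAlgebra ι P) := by
    refine Algebra.isMulCommutative_adjoin K ?_
    rintro _ ⟨s, rfl⟩ _ ⟨t, rfl⟩
    exact LinearMap.ext fun F => pDelta_comm P s t F
  inferInstance

/-- The action of polynomials on functions of integer variables in which the variable `X s` acts as
the `P`-difference operator in the variable `s`. It turns identities between operators into
identities in a commutative polynomial ring. (The detour through the commutative subalgebra
generated by the difference operators is needed because `MvPolynomial.aeval` requires a commutative
target.) -/
def act (P : K) : MvPolynomial ι K →ₐ[K] Module.End K ((ι → ℤ) → K) :=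
  (pDeltaAlgebra ι P).val.comp (aeval fun s => ⟨pDeltaLin P s, Algebra.subset_adjoin ⟨s, rfl⟩⟩)

theorem act_X (P : K) (s : ι) (F : (ι → ℤ) → K) : act P (X s) F = pDelta P s F := by
  rw [act, AlgHom.comp_apply, aeval_X]
  rfl

theorem act_C (P c : K) (F : (ι → ℤ) → K) : act P (C c) F = c • F := by
  rw [← algebraMap_eq, AlgHom.commutes, Module.algebraMap_end_apply]

theorem act_add (P : K) (p q : MvPolynomial ι K) (F : (ι → ℤ) → K) :
    act P (p + q) F = act P p F + act P q F := by
  rw [map_add, LinearMap.add_apply]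

theorem act_sub (P : K) (p q : MvPolynomial ι K) (F : (ι → ℤ) → K) :
    act P (p - q) F = act P p F - act P q F := by
  rw [map_sub, LinearMap.sub_apply]

theorem act_mul (P : K) (p q : MvPolynomial ι K) (F : (ι → ℤ) → K) :
    act P (p * q) F = act P p (act P q F) := by
  rw [map_mul, Module.End.mul_apply]

theorem act_comm (P : K) (p q : MvPolynomial ι K) (F : (ι → ℤ) → K) :
    act P p (act P q F) = act P q (act P p F) := by
  rw [← act_mul, mul_comm, act_mul]

theorem act_X_pow (P : K) (s : ι) (r : ℕ) (F : (ι → ℤ) → K) :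
    act P (X s ^ r) F = (pDelta P s)^[r] F := by
  induction r generalizing F with
  | zero => rw [pow_zero, map_one, Module.End.one_apply, Function.iterate_zero_apply]
  | succ r ih => rw [pow_succ, act_mul, ih, act_X, Function.iterate_succ_apply]

theorem pDelta_iterate_act (P : K) (s : ι) (r : ℕ) (p : MvPolynomial ι K) (F : (ι → ℤ) → K) :
    (pDelta P s)^[r] (act P p F) = act P p ((pDelta P s)^[r] F) := by
  rw [← act_X_pow, act_comm, act_X_pow]

theorem act_comp_of_pDelta_comp (P : K) (φ : (ι → ℤ) → (κ → ℤ))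
    (θ : MvPolynomial ι K →ₐ[K] MvPolynomial κ K)
    (h : ∀ i (F : (κ → ℤ) → K), pDelta P i (F ∘ φ) = act P (θ (X i)) F ∘ φ)
    (p : MvPolynomial ι K) (F : (κ → ℤ) → K) : act P p (F ∘ φ) = act P (θ p) F ∘ φ := by
  induction p using MvPolynomial.induction_on generalizing F with
  | C c => rw [act_C, ← algebraMap_eq, AlgHom.commutes, algebraMap_eq, act_C]; rfl
  | add p q hp hq => rw [act_add, map_add, act_add, hp, hq]; rfl
  | mul_X p i hp => rw [act_mul, act_X, h, hp, map_mul, act_mul]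

theorem act_comp_rename (P : K) (φ : (ι → ℤ) → (κ → ℤ)) (σ : ι → κ)
    (hφ : ∀ z i, φ z (σ i) = z i)
    (hφ_update : ∀ z i v, φ (Function.update z i v) = Function.update (φ z) (σ i) v)
    (p : MvPolynomial ι K) (F : (κ → ℤ) → K) :
    act P p (F ∘ φ) = act P (rename σ p) F ∘ φ := by
  refine act_comp_of_pDelta_comp P φ (rename σ) (fun i F => ?_) p F
  ext z
  simp only [rename_X, act_X, pDelta, shift, Function.comp_apply, hφ, hφ_update]

omit [DecidableEq ι] in
theorem act_rename_eq_zero_of_eq (P : K) (σ : ι → κ) {i j : κ} (hi : ∀ a, σ a ≠ i)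
    (hj : ∀ a, σ a ≠ j) (p : MvPolynomial ι K) {F : (κ → ℤ) → K}
    (hF : ∀ x, x i = x j → F x = 0) {x : κ → ℤ} (hx : x i = x j) :
    act P (rename σ p) F x = 0 := by
  induction p using MvPolynomial.induction_on generalizing F with
  | C c => rw [rename_C, act_C, Pi.smul_apply, hF x hx, smul_zero]
  | add p q hp hq => rw [map_add, act_add, Pi.add_apply, hp hF, hq hF, add_zero]
  | mul_X p a hp =>
    rw [map_mul, rename_X, act_mul, act_X]
    refine hp fun y hy => ?_
    have hy' : Function.update y (σ a) (y (σ a) + 1) i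
        = Function.update y (σ a) (y (σ a) + 1) j := by
      rwa [Function.update_of_ne (hi a).symm, Function.update_of_ne (hj a).symm]
    rw [pDelta, shift, hF y hy, hF _ hy', sub_zero, mul_zero]

/-- The functions of `P`-degree less than `R` in each variable, i.e. those annihilated by the
`R`-th power of each `P`-difference operator. On them the integer powers of the `P`-shift operators
act as polynomials in the difference operators. -/
def degreeLT (ι : Type*) [DecidableEq ι] (P : K) (R : ℕ) : Submodule K ((ι → ℤ) → K) :=
  ⨅ s, LinearMap.ker (act P (X s ^ R))

theorem mem_degreeLT {P : K} {R : ℕ} {F : (ι → ℤ) → K} :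
    F ∈ degreeLT ι P R ↔ ∀ s, (pDelta P s)^[R] F = 0 := by
  simp only [degreeLT, Submodule.mem_iInf, LinearMap.mem_ker, act_X_pow]

theorem act_mem_degreeLT {P : K} {R : ℕ} {F : (ι → ℤ) → K} (hF : F ∈ degreeLT ι P R)
    (p : MvPolynomial ι K) : act P p F ∈ degreeLT ι P R := by
  rw [mem_degreeLT] at hF ⊢
  intro s
  rw [pDelta_iterate_act, hF, map_zero]

theorem pDelta_mem_degreeLT {P : K} {R : ℕ} {F : (ι → ℤ) → K} (hF : F ∈ degreeLT ι P R) (s : ι) :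
    pDelta P s F ∈ degreeLT ι P R :=
  act_X P s F ▸ act_mem_degreeLT hF (X s)

theorem comp_mem_degreeLT {P : K} {R : ℕ} {F : (κ → ℤ) → K} (hF : F ∈ degreeLT κ P R)
    (φ : (ι → ℤ) → (κ → ℤ)) (σ : ι → κ) (hφ : ∀ z i, φ z (σ i) = z i)
    (hφ_update : ∀ z i v, φ (Function.update z i v) = Function.update (φ z) (σ i) v) :
    F ∘ φ ∈ degreeLT ι P R := by
  rw [mem_degreeLT] at hF ⊢
  intro s
  rw [← act_X_pow, act_comp_rename P φ σ hφ hφ_update, map_pow, rename_X, act_X_pow, hF]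
  rfl

end Action

section OperatorPolynomials

variable {ι κ : Type*}

/-- The polynomial in the `P`-difference operator that represents the `i`-th power of the `P`-shift
on functions annihilated by the `R`-th power of the `P`-difference. -/
def shiftPoly (K : Type*) [Field K] (R : ℕ) : ℤ → Polynomial K
  | Int.ofNat i => (Polynomial.X + 1) ^ i
  | Int.negSucc i => (∑ j ∈ Finset.range R, (-1) ^ j * Polynomial.X ^ j) ^ (i + 1)

/-- The polynomial in two difference operators that represents `laurentOp P S f` on functions
annihilated by their `R`-th powers. -/
def laurentPoly (R : ℕ) (S : Finset (ℤ × ℤ)) (f : S → K) : MvPolynomial (Fin 2) K :=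
  ∑ p : S, C (f p) * (Polynomial.aeval (X 0) (shiftPoly K R p.1.1) *
    Polynomial.aeval (X 1) (shiftPoly K R p.1.2))

/-- The polynomial representing `pqShift P Q t`. -/
def shiftFactor (Q : K) (t : ι) : MvPolynomial ι K := C Q + X t

/-- The polynomial representing `pqId P Q s`. -/
def idFactor (Q : K) (s : ι) : MvPolynomial ι K := C Q + C (Q - 1) * X s

/-- The polynomial representing the factor `V_{s,t}`, in which an arbitrary polynomial `w` stands
for the Laurent operator. -/
def factorPoly (Q : K) (w : MvPolynomial (Fin 2) K) (s t : ι) : MvPolynomial ι K :=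
  shiftFactor Q t * idFactor Q s - X s * X t * rename ![t, s] w

theorem rename_shiftFactor (Q : K) (σ : ι → κ) (t : ι) :
    rename σ (shiftFactor Q t) = shiftFactor Q (σ t) := by
  simp only [shiftFactor, map_add, rename_C, rename_X]

theorem rename_idFactor (Q : K) (σ : ι → κ) (s : ι) :
    rename σ (idFactor Q s) = idFactor Q (σ s) := by
  simp only [idFactor, map_add, map_mul, rename_C, rename_X]

theorem rename_rename_pair (w : MvPolynomial (Fin 2) K) (σ : ι → κ) (s t : ι) :
    rename σ (rename ![s, t] w) = rename ![σ s, σ t] w := by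
  rw [rename_rename, show σ ∘ ![s, t] = ![σ s, σ t] from List.ofFn_injective rfl]

theorem rename_factorPoly (Q : K) (w : MvPolynomial (Fin 2) K) (σ : ι → κ) (s t : ι) :
    rename σ (factorPoly Q w s t) = factorPoly Q w (σ s) (σ t) := by
  simp only [factorPoly, map_sub, map_mul, rename_shiftFactor, rename_idFactor, rename_X,
    rename_rename_pair]

variable [DecidableEq ι]

theorem pShift_eq_act (P : K) (s : ι) (F : (ι → ℤ) → K) : pShift P s F = act P (X s + 1) F := by
  rw [act_add, act_X, map_one, Module.End.one_apply, pShift]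

theorem pqShift_eq_act (P Q : K) (s : ι) (F : (ι → ℤ) → K) :
    pqShift P Q s F = act P (shiftFactor Q s) F := by
  rw [shiftFactor, act_add, act_X, act_C, pqShift]

theorem pqId_eq_act (P Q : K) (s : ι) (F : (ι → ℤ) → K) :
    pqId P Q s F = act P (idFactor Q s) F := by
  rw [idFactor, act_add, act_mul, act_X, act_C, act_C, pqId, pShift, smul_add, sub_smul, one_smul]
  abel

theorem pShiftInv_eq_act (P : K) (s : ι) {R : ℕ} {F : (ι → ℤ) → K}
    (hF : (pDelta P s)^[R] F = 0) :
    pShiftInv P s F = act P (∑ j ∈ Finset.range R, (-1) ^ j * X s ^ j) F := by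
  have hzero : ∀ j, R ≤ j → (pDelta P s)^[j] F = 0 := fun j hj => by
    rw [← Nat.sub_add_cancel hj, Function.iterate_add_apply, hF, ← act_X_pow, map_zero]
  have hterm : ∀ j, act P ((-1) ^ j * X s ^ j) F = (-1 : K) ^ j • (pDelta P s)^[j] F := fun j => by
    rw [act_mul, act_X_pow, ← act_C P, C_pow, C_neg, C_1]
  ext k
  rw [pShiftInv, finsum_eq_sum_of_support_subset (s := Finset.range R)]
  · simp only [map_sum, LinearMap.sum_apply, hterm, Finset.sum_apply, Pi.smul_apply, smul_eq_mul]
  · refine Function.support_subset_iff'.2 fun j hj => ?_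
    rw [hzero j (by simpa using hj), Pi.zero_apply, mul_zero]

theorem pShiftInv_iterate_eq_act (P : K) (s : ι) {R : ℕ} {F : (ι → ℤ) → K}
    (hF : (pDelta P s)^[R] F = 0) (i : ℕ) :
    (pShiftInv P s)^[i] F = act P ((∑ j ∈ Finset.range R, (-1) ^ j * X s ^ j) ^ i) F := by
  induction i with
  | zero => rw [pow_zero, map_one, Module.End.one_apply, Function.iterate_zero_apply]
  | succ i ih =>
    rw [Function.iterate_succ_apply', ih, pShiftInv_eq_act P s (R := R), pow_succ', act_mul]
    rw [pDelta_iterate_act, hF, map_zero]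

theorem pShift_iterate_eq_act (P : K) (s : ι) (F : (ι → ℤ) → K) (i : ℕ) :
    (pShift P s)^[i] F = act P ((X s + 1) ^ i) F := by
  induction i with
  | zero => rw [pow_zero, map_one, Module.End.one_apply, Function.iterate_zero_apply]
  | succ i ih => rw [Function.iterate_succ_apply', ih, pShift_eq_act, pow_succ', act_mul]

theorem pShiftPow_eq_act (P : K) (s : ι) {R : ℕ} {F : (ι → ℤ) → K}
    (hF : (pDelta P s)^[R] F = 0) (i : ℤ) :
    pShiftPow P s i F = act P (Polynomial.aeval (X s) (shiftPoly K R i)) F := by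
  rcases i with i | i <;>
    simp only [pShiftPow, shiftPoly, map_pow, map_sum, map_add, map_mul, map_neg, map_one,
      Polynomial.aeval_X]
  · simp only [pShift_iterate_eq_act, map_pow, map_add, map_one]
  · simp only [pShiftInv_iterate_eq_act P s hF, map_pow, map_sum, map_mul, map_neg, map_one]

theorem laurentOp_eq_act (P : K) {R : ℕ} (S : Finset (ℤ × ℤ)) (f : S → K) (x y : ι)
    {F : (ι → ℤ) → K} (hF : F ∈ degreeLT ι P R) :
    laurentOp P S f x y F = act P (rename ![x, y] (laurentPoly R S f)) F := by
  rw [laurentOp, laurentPoly, map_sum, map_sum, LinearMap.sum_apply]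
  refine Finset.sum_congr rfl fun p _ => ?_
  have hFy := act_mem_degreeLT hF (Polynomial.aeval (X y) (shiftPoly K R p.1.2))
  rw [pShiftPow_eq_act P y (mem_degreeLT.1 hF y), pShiftPow_eq_act P x (mem_degreeLT.1 hFy x),
    map_mul, rename_C, act_mul, act_C, map_mul, act_mul,
    ← Polynomial.aeval_algHom_apply (rename _), ← Polynomial.aeval_algHom_apply (rename _),
    rename_X, rename_X]
  rfl

theorem factorOp_eq_act (P Q : K) {R : ℕ} (S : Finset (ℤ × ℤ)) (f : S → K) (s t : ι)
    {F : (ι → ℤ) → K} (hF : F ∈ degreeLT ι P R) :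
    factorOp P Q S f s t F = act P (factorPoly Q (laurentPoly R S f) s t) F := by
  rw [factorOp, factorPoly, act_sub, act_mul, act_mul, act_mul, pqShift_eq_act, pqId_eq_act,
    laurentOp_eq_act P S f t s hF, act_X, act_X]

theorem opProd_factorOp_eq_act (P Q : K) {R : ℕ} (S : Finset (ℤ × ℤ)) (f : S → K)
    (L : List (ι × ι)) {F : (ι → ℤ) → K} (hF : F ∈ degreeLT ι P R) :
    opProd (factorOp P Q S f) L F
      = act P (L.map fun p => factorPoly Q (laurentPoly R S f) p.1 p.2).prod F := by
  induction L with
  | nil => rw [List.map_nil, List.prod_nil, map_one, Module.End.one_apply]; rfl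
  | cons p L ih =>
    rw [List.map_cons, List.prod_cons, act_mul, ← ih,
      ← factorOp_eq_act P Q S f p.1 p.2 (ih ▸ act_mem_degreeLT hF _)]
    rfl

end OperatorPolynomials

section SummationOperator

theorem signedSum_eq_add (a b : ℤ) (g : ℤ → K) :
    signedSum a b g = signedSum a (b - 1) g + g b := by
  unfold signedSum
  rcases lt_trichotomy a b with h | rfl | h
  · have hIcc : Finset.Icc a b = insert b (Finset.Icc a (b - 1)) := by
      ext y; simp only [Finset.mem_Icc, Finset.mem_insert]; omega
    rw [if_pos h.le, if_pos (by omega), hIcc, Finset.sum_insert (by simp), add_comm]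
  · simp
  · have hIcc : Finset.Icc b (a - 1) = insert b (Finset.Icc (b + 1) (a - 1)) := by
      ext y; simp only [Finset.mem_Icc, Finset.mem_insert]; omega
    rw [if_neg (by omega), if_neg (by omega), sub_add_cancel, hIcc, Finset.sum_insert (by simp)]
    ring

theorem signedSum_eq_sub {g G : ℤ → K} (hG : ∀ x, G (x + 1) = G x + g x) (a x : ℤ) :
    signedSum a (x - 1) g = G x - G a := by
  induction x using Int.inductionOn' (b := a) with
  | zero => simp [signedSum]
  | succ x _ ih => rw [signedSum_eq_add, add_sub_cancel_right, ih, hG]; ring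
  | pred x _ ih =>
    have hx := hG (x - 1)
    rw [signedSum_eq_add] at ih
    rw [sub_add_cancel] at hx
    linear_combination ih + hx

theorem mainTerm_eq_sub {P Q : K} (hP : P ≠ 0) (hQ : Q ≠ 0) {G H : ℤ → K}
    (hH : ∀ x, H (x + 1) = H x + P ^ x * G x) (a b : ℤ) :
    mainTerm P Q G a b = (Q * H a + G a) - (Q * H b + (Q - 1) * G b) := by
  have hsum : (fun z : Fin 2 → ℤ => signedSum (z 1) (z 0 - 1) fun l => P ^ l * G l)
      = fun z => H (z 0) - H (z 1) := funext fun z => signedSum_eq_sub hH _ _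
  have ha : P ^ a ≠ 0 := zpow_ne_zero _ hP
  have hb : P ^ b ≠ 0 := zpow_ne_zero _ hP
  rw [mainTerm, hsum]
  simp only [pqShift, pqId, pShift, pDelta, shift, Pi.add_apply, Pi.sub_apply, Pi.smul_apply,
    smul_eq_mul]
  simp only [Matrix.cons_val_one, Matrix.cons_val_fin_one, zpow_neg, ne_eq, zero_ne_one,
    not_false_eq_true, Function.update_of_ne, Matrix.cons_val_zero, Function.update_self, hH,
    sub_sub_sub_cancel_left, sub_add_cancel_left, mul_neg, sub_neg_eq_add, one_ne_zero,
    add_sub_add_right_eq_sub]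
  field_simp
  ring

variable {n : ℕ}

/-- Fixing the last variable of a function to the value `x`, as a linear map. -/
def slice (x : ℤ) : ((Fin (n + 1) → ℤ) → K) →ₗ[K] ((Fin n → ℤ) → K) :=
  LinearMap.funLeft K K fun l => Fin.snoc l x

theorem slice_apply (x : ℤ) (F : (Fin (n + 1) → ℤ) → K) (l : Fin n → ℤ) :
    slice x F l = F (Fin.snoc l x) :=
  rfl

theorem slice_last_init (F : (Fin (n + 1) → ℤ) → K) (k : Fin (n + 1) → ℤ) :
    slice (k (Fin.last n)) F (Fin.init k) = F k := by
  rw [slice_apply, Fin.snoc_init_self]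

theorem act_slice (P : K) (x : ℤ) (p : MvPolynomial (Fin n) K) (F : (Fin (n + 1) → ℤ) → K) :
    act P p (slice x F) = slice x (act P (rename Fin.castSucc p) F) :=
  act_comp_rename P (fun l => Fin.snoc (α := fun _ => ℤ) l x) Fin.castSucc (by simp)
    (by simp [Fin.snoc_update]) p F

theorem slice_add_one {P : K} (hP : P ≠ 0) (F : (Fin (n + 1) → ℤ) → K) (x : ℤ) :
    slice (x + 1) F = slice x F + P ^ x • slice x (pDelta P (Fin.last n) F) := by
  ext l
  have hx : P ^ x ≠ 0 := zpow_ne_zero _ hP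
  simp only [Pi.add_apply, Pi.smul_apply, smul_eq_mul, slice_apply, pDelta, shift,
    Fin.update_snoc_last, Fin.snoc_last, zpow_neg]
  field_simp
  ring

theorem slice_mem_degreeLT {P : K} {R : ℕ} {F : (Fin (n + 1) → ℤ) → K}
    (hF : F ∈ degreeLT (Fin (n + 1)) P R) (x : ℤ) : slice x F ∈ degreeLT (Fin n) P R :=
  comp_mem_degreeLT hF (fun l => Fin.snoc (α := fun _ => ℤ) l x) Fin.castSucc (by simp)
    (by simp [Fin.snoc_update])

theorem prod_X_succ :
    ∏ s, X s = rename Fin.castSucc (∏ s : Fin n, X s) * (X (Fin.last n) : MvPolynomial _ K) := by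
  simp only [Fin.prod_univ_castSucc, map_prod, rename_X]

theorem slice_act_prod_X (P : K) (x : ℤ) (F : (Fin (n + 1) → ℤ) → K) :
    slice x (act P (∏ s, X s) F) = act P (∏ s, X s) (slice x (pDelta P (Fin.last n) F)) := by
  rw [act_slice, ← act_X, ← act_mul, prod_X_succ]

theorem mainTerm_slice {P Q : K} (hP : P ≠ 0) (hQ : Q ≠ 0) (Λ : ((Fin n → ℤ) → K) →ₗ[K] K)
    (F : (Fin (n + 1) → ℤ) → K) (a b : ℤ) :
    mainTerm P Q (fun x => Λ (slice x (pDelta P (Fin.last n) F))) a b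
      = Λ (slice a (act P (shiftFactor Q (Fin.last n)) F))
        - Λ (slice b (act P (idFactor Q (Fin.last n)) F)) := by
  rw [mainTerm_eq_sub hP hQ (H := fun x => Λ (slice x F)) fun x => by
    rw [slice_add_one hP, map_add, map_smul, smul_eq_mul]]
  simp only [shiftFactor, idFactor, act_add, act_mul, act_C, act_X]
  simp only [map_add, map_smul, smul_eq_mul]

theorem laurentOp_slice (P : K) {R : ℕ} (S : Finset (ℤ × ℤ)) (f : S → K)
    {F : (Fin (n + 2) → ℤ) → K} (hF : F ∈ degreeLT (Fin (n + 2)) P R) (a b : ℤ) :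
    (fun l : Fin n → ℤ => laurentOp P S f (0 : Fin 2) (1 : Fin 2)
        (fun z => F (Fin.snoc (α := fun _ => ℤ) (Fin.snoc (α := fun _ => ℤ) l (z 0)) (z 1)))
        ![a, b])
      = slice a (slice b
          (act P (rename ![(Fin.last n).castSucc, Fin.last (n + 1)] (laurentPoly R S f)) F)) := by
  ext l
  have hlast : ∀ (z : Fin 2 → ℤ) i, (Fin.snoc (α := fun _ => ℤ)
      (Fin.snoc (α := fun _ => ℤ) l (z 0)) (z 1) : Fin (n + 2) → ℤ)
        (![(Fin.last n).castSucc, Fin.last (n + 1)] i) = z i := by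
    intro z i
    fin_cases i <;> simp
  have hupdate : ∀ (z : Fin 2 → ℤ) i v, (Fin.snoc (α := fun _ => ℤ) (Fin.snoc (α := fun _ => ℤ) l
      (Function.update z i v 0)) (Function.update z i v 1) : Fin (n + 2) → ℤ)
        = Function.update (Fin.snoc (α := fun _ => ℤ) (Fin.snoc (α := fun _ => ℤ) l (z 0)) (z 1))
          (![(Fin.last n).castSucc, Fin.last (n + 1)] i) v := by
    intro z i v
    fin_cases i
    · simp [← Fin.snoc_update, Fin.update_snoc_last]
    · simp [Fin.update_snoc_last]
  have hmem := comp_mem_degreeLT hF _ _ hlast hupdate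
  have hid : rename ![(0 : Fin 2), 1] (laurentPoly R S f) = laurentPoly R S f := by
    rw [show ![(0 : Fin 2), 1] = id from List.ofFn_injective rfl, rename_id_apply]
  refine (congrFun (laurentOp_eq_act P S f 0 1 hmem) _).trans ?_
  rw [hid, act_comp_rename P _ _ hlast hupdate]
  rfl

/-- The product of the operators `idFactor` in the variables before position `r`, and of the
operators `shiftFactor` in those after it. -/
def splitFactor (Q : K) (r : Fin (n + 1)) : MvPolynomial (Fin n) K :=
  ∏ i : Fin n, if i.castSucc < r then idFactor Q i else shiftFactor Q i

theorem splitFactor_castSucc (Q : K) (r : Fin (n + 1)) :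
    splitFactor Q r.castSucc
      = rename Fin.castSucc (splitFactor Q r) * shiftFactor Q (Fin.last n) := by
  simp only [splitFactor, Fin.prod_univ_castSucc, Fin.castSucc_lt_castSucc_iff,
    (Fin.le_last r).not_gt, if_false, map_prod, apply_ite (rename Fin.castSucc), rename_idFactor,
    rename_shiftFactor]

theorem splitFactor_last (Q : K) :
    splitFactor Q (Fin.last (n + 1))
      = rename Fin.castSucc (splitFactor Q (Fin.last n)) * idFactor Q (Fin.last n) := by
  simp only [splitFactor, Fin.prod_univ_castSucc, Fin.castSucc_lt_last, if_true, map_prod,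
    rename_idFactor]

/-- The value of the summation operator on a function with antidifference `F`: the alternating sum
over the omission of one of the upper indices, where the omitted index splits the remaining
variables into those acted on by `idFactor` and those acted on by `shiftFactor`. -/
def splitSum (P Q : K) (k : Fin (n + 1) → ℤ) : ((Fin n → ℤ) → K) →ₗ[K] K :=
  ∑ r : Fin (n + 1),
    (-1 : K) ^ (r : ℕ) • LinearMap.proj (k ∘ r.succAbove) ∘ₗ act P (splitFactor Q r)

theorem splitSum_apply (P Q : K) (k : Fin (n + 1) → ℤ) (F : (Fin n → ℤ) → K) :
    splitSum P Q k F
      = ∑ r : Fin (n + 1), (-1) ^ (r : ℕ) * act P (splitFactor Q r) F (k ∘ r.succAbove) := by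
  simp only [splitSum, LinearMap.sum_apply, LinearMap.smul_apply, LinearMap.comp_apply,
    LinearMap.proj_apply, smul_eq_mul]

theorem splitSum_zero (P Q : K) (k : Fin 1 → ℤ) (F : (Fin 0 → ℤ) → K) :
    splitSum P Q k F = F ![] := by
  rw [splitSum_apply, Fin.sum_univ_one, splitFactor, Fin.prod_univ_zero, map_one,
    Module.End.one_apply, Fin.val_zero, pow_zero, one_mul, Matrix.empty_eq (k ∘ _)]

theorem snoc_init_comp_succAbove (k : Fin (n + 2) → ℤ) (r : Fin (n + 1)) :
    (Fin.snoc (Fin.init k ∘ r.succAbove) (k (Fin.last (n + 1))) : Fin (n + 1) → ℤ)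
      = k ∘ r.castSucc.succAbove := by
  ext i
  refine Fin.lastCases ?_ (fun i => ?_) i
  · simp [Fin.succAbove_of_le_castSucc, Fin.le_last]
  · simp [Fin.init, Fin.castSucc_succAbove_castSucc]

theorem splitSum_succ (P Q : K) (k : Fin (n + 2) → ℤ) (F : (Fin (n + 1) → ℤ) → K) :
    splitSum P Q k F
      = splitSum P Q (Fin.init k)
          (slice (k (Fin.last (n + 1))) (act P (shiftFactor Q (Fin.last n)) F))
        + (-1) ^ (n + 1) * act P (splitFactor Q (Fin.last (n + 1))) F (Fin.init k) := by
  rw [splitSum_apply, splitSum_apply, Fin.sum_univ_castSucc, Fin.succAbove_last, Fin.val_last]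
  congr 1
  refine Finset.sum_congr rfl fun r _ => ?_
  rw [act_slice, slice_apply, snoc_init_comp_succAbove, ← act_mul, splitFactor_castSucc,
    Fin.val_castSucc]

theorem act_splitFactor_last_slice (P Q : K) (k : Fin (n + 1) → ℤ) (F : (Fin (n + 1) → ℤ) → K) :
    act P (splitFactor Q (Fin.last n))
        (slice (k (Fin.last n)) (act P (idFactor Q (Fin.last n)) F)) (Fin.init k)
      = act P (splitFactor Q (Fin.last (n + 1))) F k := by
  rw [act_slice, slice_last_init, splitFactor_last, act_mul]

theorem mainTerm_splitSum_zero {P Q : K} (hP : P ≠ 0) (hQ : Q ≠ 0) (k : Fin 2 → ℤ)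
    (F : (Fin 1 → ℤ) → K) :
    mainTerm P Q (fun x => splitSum P Q (Fin.init k) (slice x (pDelta P (Fin.last 0) F)))
        (k 1) (k 0) = splitSum P Q k F := by
  have hinit := act_splitFactor_last_slice P Q (Fin.init k) F
  rw [splitFactor, Fin.prod_univ_zero, map_one, Module.End.one_apply] at hinit
  rw [mainTerm_slice hP hQ, splitSum_succ, splitSum_zero _ _ _ (slice (k 0) _), ← hinit,
    Matrix.empty_eq (Fin.init (Fin.init k)), pow_one, neg_one_mul, sub_eq_add_neg]
  rfl

theorem mainTerm_splitSum_succ {P Q : K} (hP : P ≠ 0) (hQ : Q ≠ 0) (k : Fin (n + 3) → ℤ)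
    (F : (Fin (n + 2) → ℤ) → K) (b : ℤ) (hb : k (Fin.last (n + 1)).castSucc = b) :
    mainTerm P Q (fun x => splitSum P Q (Fin.init k) (slice x (pDelta P (Fin.last (n + 1)) F)))
        (k (Fin.last (n + 2))) b
      = splitSum P Q k F - splitSum P Q (Fin.init (Fin.init k)) (slice b (slice b
          (act P (shiftFactor Q (Fin.last n).castSucc * idFactor Q (Fin.last (n + 1))) F))) := by
  have hinit := act_splitFactor_last_slice P Q (Fin.init k) F
  rw [show Fin.init k (Fin.last (n + 1)) = b from hb] at hinit
  rw [mainTerm_slice hP hQ, splitSum_succ P Q k,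
    splitSum_succ P Q (Fin.init k) (slice b _), show Fin.init k (Fin.last (n + 1)) = b from hb,
    hinit, act_slice, rename_shiftFactor, ← act_mul]
  ring

/-- The condition on an antidifference `F` that makes the second term of the recursion cancel the
part of the first one which is not in `splitSum P Q k F`. -/
def VanishesOnAdjacent (P Q : K) (w : MvPolynomial (Fin 2) K) (F : (Fin n → ℤ) → K) : Prop :=
  ∀ i j : Fin n, (j : ℕ) = i + 1 → ∀ x, x i = x j → act P (factorPoly Q w j i) F x = 0

theorem VanishesOnAdjacent.act_rename_comp {P Q : K} {w : MvPolynomial (Fin 2) K} {m : ℕ}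
    {α : Type*} {F : (Fin n → ℤ) → K} (hF : VanishesOnAdjacent P Q w F)
    (φ : (Fin m → ℤ) → (Fin n → ℤ)) (σ : Fin m → Fin n) (hφ : ∀ z i, φ z (σ i) = z i)
    (hφ_update : ∀ z i v, φ (Function.update z i v) = Function.update (φ z) (σ i) v)
    (hσ : ∀ i j : Fin m, (j : ℕ) = i + 1 → (σ j : ℕ) = σ i + 1) (τ : α → Fin n)
    (hτ : ∀ a i, τ a ≠ σ i) (p : MvPolynomial α K) :
    VanishesOnAdjacent P Q w (act P (rename τ p) F ∘ φ) := by
  intro i j hij x hx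
  rw [act_comp_rename P φ σ hφ hφ_update, Function.comp_apply, rename_factorPoly, act_comm]
  exact act_rename_eq_zero_of_eq P τ (hτ · i) (hτ · j) p (hF _ _ (hσ i j hij))
    (by rw [hφ, hφ, hx])

theorem VanishesOnAdjacent.slice {P Q : K} {w : MvPolynomial (Fin 2) K}
    {F : (Fin (n + 1) → ℤ) → K} (hF : VanishesOnAdjacent P Q w F) (x : ℤ) :
    VanishesOnAdjacent P Q w (slice x (pDelta P (Fin.last n) F)) := by
  rw [← act_X, ← rename_X (fun _ : Unit => Fin.last n) ()]
  exact hF.act_rename_comp (fun l => Fin.snoc (α := fun _ => ℤ) l x) Fin.castSucc (by simp)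
    (by simp [Fin.snoc_update]) (by simp) _ (fun _ i => (Fin.castSucc_lt_last i).ne') _

theorem VanishesOnAdjacent.slice_slice {P Q : K} {w : MvPolynomial (Fin 2) K}
    {F : (Fin (n + 2) → ℤ) → K} (hF : VanishesOnAdjacent P Q w F) (a b : ℤ)
    (p : MvPolynomial (Fin 2) K) :
    VanishesOnAdjacent P Q w (OperatorFormula.slice a (OperatorFormula.slice b
      (act P (rename ![(Fin.last n).castSucc, Fin.last (n + 1)] p) F))) := by
  refine hF.act_rename_comp
    (fun l => Fin.snoc (α := fun _ => ℤ) (Fin.snoc (α := fun _ => ℤ) l a) b)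
    (Fin.castSucc ∘ Fin.castSucc) (by simp) (by simp [Fin.snoc_update]) (by simp) _ ?_ p
  simp [Fin.forall_fin_two, (Fin.castSucc_lt_last _).ne']

theorem rename_X_mul_X_mul (i j : Fin n) (w : MvPolynomial (Fin 2) K) :
    rename ![i, j] (X 0 * X 1 * w) = X i * X j * rename ![i, j] w := by
  simp only [map_mul, rename_X, Matrix.cons_val_zero, Matrix.cons_val_one]

theorem slice_slice_eq_of_vanishesOnAdjacent {P Q : K} {w : MvPolynomial (Fin 2) K}
    {F : (Fin (n + 2) → ℤ) → K} (hF : VanishesOnAdjacent P Q w F) (b : ℤ) :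
    slice b (slice b
        (act P (shiftFactor Q (Fin.last n).castSucc * idFactor Q (Fin.last (n + 1))) F))
      = slice b (slice b
        (act P (rename ![(Fin.last n).castSucc, Fin.last (n + 1)] (X 0 * X 1 * w)) F)) := by
  ext l
  have hl := hF (Fin.last n).castSucc (Fin.last (n + 1)) (by simp)
    (Fin.snoc (α := fun _ => ℤ) (Fin.snoc (α := fun _ => ℤ) l b) b) (by simp)
  rw [factorPoly, act_sub, Pi.sub_apply, sub_eq_zero] at hl
  rw [rename_X_mul_X_mul, mul_comm (X (Fin.last n).castSucc)]
  exact hl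

theorem laurentOp_slice_act_prod_X (P : K) {R : ℕ} (S : Finset (ℤ × ℤ)) (f : S → K)
    {F : (Fin (n + 2) → ℤ) → K} (hF : F ∈ degreeLT (Fin (n + 2)) P R) (a b : ℤ) :
    (fun l : Fin n → ℤ => laurentOp P S f (0 : Fin 2) (1 : Fin 2)
        (fun z => act P (∏ s, X s) F
          (Fin.snoc (α := fun _ => ℤ) (Fin.snoc (α := fun _ => ℤ) l (z 0)) (z 1))) ![a, b])
      = act P (∏ s, X s) (slice a (slice b (act P
          (rename ![(Fin.last n).castSucc, Fin.last (n + 1)] (X 0 * X 1 * laurentPoly R S f))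
            F))) := by
  rw [laurentOp_slice P S f (act_mem_degreeLT hF _), act_slice, act_slice, ← act_mul, ← act_mul,
    rename_X_mul_X_mul, prod_X_succ, prod_X_succ, map_mul (rename Fin.castSucc), rename_X]
  refine congrArg (fun p => slice a (slice b (act P p F))) ?_
  ring

theorem sumOp_act_prod_X {P Q : K} (hP : P ≠ 0) (hQ : Q ≠ 0) {R : ℕ} (S : Finset (ℤ × ℤ))
    (f : S → K) : ∀ (n : ℕ) {F : (Fin n → ℤ) → K}, F ∈ degreeLT (Fin n) P R →
      VanishesOnAdjacent P Q (laurentPoly R S f) F → ∀ k : Fin (n + 1) → ℤ,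
        sumOp P Q S f n (act P (∏ s, X s) F) k = splitSum P Q k F
  | 0, F, _, _, k => by
    rw [splitSum_zero, sumOp, Fin.prod_univ_zero, map_one, Module.End.one_apply]
  | 1, F, hF, hV, k => by
    have hslice : ∀ x, splitSum P Q (Fin.init k) (slice x (pDelta P (Fin.last 0) F))
        = sumOp P Q S f 0 (slice x (act P (∏ s, X s) F)) (Fin.init k) := fun x => by
      rw [slice_act_prod_X, sumOp_act_prod_X hP hQ S f 0
        (slice_mem_degreeLT (pDelta_mem_degreeLT hF _) x) (hV.slice x)]
    rw [← mainTerm_splitSum_zero hP hQ, funext hslice]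
    rfl
  | n + 2, F, hF, hV, k => by
    have hslice : ∀ x, splitSum P Q (Fin.init k) (slice x (pDelta P (Fin.last (n + 1)) F))
        = sumOp P Q S f (n + 1) (slice x (act P (∏ s, X s) F)) (Fin.init k) := fun x => by
      rw [slice_act_prod_X, sumOp_act_prod_X hP hQ S f (n + 1)
        (slice_mem_degreeLT (pDelta_mem_degreeLT hF _) x) (hV.slice x)]
    have hmain := mainTerm_splitSum_succ hP hQ k F _ rfl
    rw [funext hslice, slice_slice_eq_of_vanishesOnAdjacent hV, ← sumOp_act_prod_X hP hQ S f n
      (slice_mem_degreeLT (slice_mem_degreeLT (act_mem_degreeLT hF _) _) _)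
      (hV.slice_slice _ _ _), ← laurentOp_slice_act_prod_X P S f hF] at hmain
    exact eq_sub_iff_add_eq.1 hmain

end SummationOperator

section Determinant

/-- The `P`-difference of a function of a single integer variable. -/
def delta (P : K) (g : ℤ → K) : ℤ → K := fun x => P ^ (-x) * (g (x + 1) - g x)

theorem delta_smul (P c : K) (g : ℤ → K) : delta P (c • g) = c • delta P g := by
  ext x; simp only [delta, Pi.smul_apply, smul_eq_mul]; ring

theorem delta_iterate_smul (P c : K) (g : ℤ → K) (r : ℕ) :
    (delta P)^[r] (c • g) = c • (delta P)^[r] g :=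
  (Function.Semiconj.iterate_right (f := (c • ·)) (fun g => (delta_smul P c g).symm) r g).symm

theorem delta_zero (P : K) : delta P 0 = 0 := by
  ext x; simp only [delta, Pi.zero_apply, sub_zero, mul_zero]

theorem delta_pBinom_zero (P : K) : delta P (fun x => pBinom P x 0) = 0 := by
  ext x; simp only [delta, pBinom, sub_self, mul_zero, Pi.zero_apply]

theorem delta_pBinom_succ {P : K} (hP : P ≠ 0) (m : ℕ) :
    delta P (fun x => pBinom P x (m + 1)) = P ^ (-(m : ℤ)) • fun x => pBinom P x m := by
  ext x
  have pascal : pBinom P (x + 1) (m + 1) - pBinom P x (m + 1)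
      = P ^ (x - (m : ℤ)) * pBinom P x m := by
    rw [pBinom, pBinom, add_sub_cancel_right, signedSum_eq_add, add_sub_cancel_left]
  simp only [delta, pascal, Pi.smul_apply, smul_eq_mul]
  rw [← mul_assoc, ← zpow_add₀ hP, ← add_sub_assoc, neg_add_cancel, zero_sub]

theorem delta_iterate_pBinom {P : K} (hP : P ≠ 0) {m r : ℕ} (h : m < r) :
    (delta P)^[r] (fun x => pBinom P x m) = 0 := by
  induction r, h using Nat.le_induction with
  | base =>
    induction m with
    | zero => rw [Function.iterate_one, delta_pBinom_zero]
    | succ m ih => rw [Function.iterate_succ_apply, delta_pBinom_succ hP, delta_iterate_smul, ih,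
        smul_zero]
  | succ r _ ih => rw [Function.iterate_succ_apply', ih, delta_zero]

variable {ι : Type*} [Fintype ι] [DecidableEq ι]

/-- The determinant of a matrix of functions of a single variable, the `i`-th row being evaluated at
the `i`-th variable. -/
def rowDet (g : ι → ι → ℤ → K) (x : ι → ℤ) : K := Matrix.det (Matrix.of fun i j => g i j (x i))

theorem rowDet_update (g : ι → ι → ℤ → K) (s : ι) (h : ι → ℤ → K) (x : ι → ℤ) :
    rowDet (Function.update g s h) x
      = ((Matrix.of fun i j => g i j (x i)).updateRow s fun j => h j (x s)).det := by
  rw [rowDet]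
  congr 1
  ext i j
  rcases eq_or_ne i s with rfl | hi
  · simp
  · simp [hi]

theorem pDelta_rowDet (P : K) (s : ι) (g : ι → ι → ℤ → K) :
    pDelta P s (rowDet g) = rowDet (Function.update g s fun j => delta P (g s j)) := by
  ext x
  have hshift : shift s (rowDet g) x
      = ((Matrix.of fun i j => g i j (x i)).updateRow s fun j => g s j (x s + 1)).det := by
    rw [shift, rowDet]
    congr 1
    ext i j
    rcases eq_or_ne i s with rfl | hi
    · simp
    · simp [hi]
  have hself : rowDet g x
      = ((Matrix.of fun i j => g i j (x i)).updateRow s fun j => g s j (x s)).det := by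
    rw [← rowDet_update, Function.update_eq_self]
  have hrow : (fun j => delta P (g s j) (x s))
      = P ^ (-x s) • ((fun j => g s j (x s + 1)) - fun j => g s j (x s)) := rfl
  rw [rowDet_update, hrow, Matrix.det_updateRow_smul, pDelta, hshift, hself]
  exact congrArg _ ((Matrix.detRowAlternating (R := K)).map_update_sub
    (fun i j => g i j (x i)) s (fun j => g s j (x s + 1)) (fun j => g s j (x s))).symm

theorem pDelta_iterate_rowDet (P : K) (s : ι) (g : ι → ι → ℤ → K) (r : ℕ) :
    (pDelta P s)^[r] (rowDet g)
      = rowDet (Function.update g s fun j => (delta P)^[r] (g s j)) := by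
  induction r with
  | zero => simp only [Function.iterate_zero_apply, Function.update_eq_self]
  | succ r ih =>
    simp only [Function.iterate_succ_apply', ih, pDelta_rowDet, Function.update_self,
      Function.update_idem]

theorem act_prod_X_rowDet (P : K) (T : Finset ι) (g : ι → ι → ℤ → K) :
    act P (∏ i ∈ T, X i) (rowDet g)
      = rowDet (T.piecewise (fun i j => delta P (g i j)) g) := by
  induction T using Finset.induction_on with
  | empty => rw [Finset.prod_empty, map_one, Module.End.one_apply, Finset.piecewise_empty]
  | insert s T hs ih =>
    rw [Finset.prod_insert hs, act_mul, ih, act_X, pDelta_rowDet, Finset.piecewise_insert,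
      Finset.piecewise_eq_of_notMem _ _ _ hs]

/-- The determinant of the `P`-binomial coefficients `[x_i choose d_j]`. -/
def detBinom (P : K) (d : ι → ℕ) : (ι → ℤ) → K := rowDet fun _ j x => pBinom P x (d j)

theorem detBinom_mem_degreeLT {P : K} (hP : P ≠ 0) {d : ι → ℕ} {R : ℕ} (hd : ∀ j, d j < R) :
    detBinom P d ∈ degreeLT ι P R := by
  refine mem_degreeLT.2 fun s => funext fun x => ?_
  rw [detBinom, pDelta_iterate_rowDet, rowDet_update]
  refine Matrix.det_eq_zero_of_row_eq_zero s fun j => ?_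
  rw [Matrix.updateRow_self, delta_iterate_pBinom hP (hd j), Pi.zero_apply]

theorem act_prod_X_detBinom {P : K} (hP : P ≠ 0) (d : ι → ℕ) :
    act P (∏ i, X i) (detBinom P fun j => d j + 1) = P ^ (-(∑ j, d j : ℕ) : ℤ) • detBinom P d := by
  ext x
  rw [detBinom, act_prod_X_rowDet, Finset.piecewise_univ, Pi.smul_apply, smul_eq_mul, zpow_neg,
    zpow_natCast, ← Finset.prod_pow_eq_pow_sum, ← Finset.prod_inv_distrib]
  simp only [delta_pBinom_succ hP, zpow_neg, zpow_natCast]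
  exact Matrix.det_mul_row _ _

theorem detBinom_comp_swap (P : K) (d : ι → ℕ) {i j : ι} (hij : i ≠ j) (x : ι → ℤ) :
    detBinom P d (x ∘ Equiv.swap i j) = -detBinom P d x := by
  have hdet := Matrix.det_permute (Equiv.swap i j) (Matrix.of fun i j => pBinom P (x i) (d j))
  rw [Equiv.Perm.sign_swap hij, Units.val_neg, Units.val_one, Int.cast_neg, Int.cast_one,
    neg_one_mul] at hdet
  exact hdet

theorem detBinom_eq_zero (P : K) (d : ι → ℕ) {i j : ι} (hij : i ≠ j) {x : ι → ℤ}
    (hx : x i = x j) : detBinom P d x = 0 :=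
  Matrix.det_zero_of_row_eq hij (funext fun a => by simp only [Matrix.of_apply, hx])

theorem detBinom_cons_zero (P : K) {n : ℕ} (d : Fin n → ℕ) (k : Fin (n + 1) → ℤ) :
    detBinom P (Fin.cons (α := fun _ => ℕ) 0 d) k
      = ∑ r : Fin (n + 1), (-1) ^ (r : ℕ) * detBinom P d (k ∘ r.succAbove) := by
  rw [detBinom, rowDet, Matrix.det_succ_column_zero]
  refine Finset.sum_congr rfl fun r _ => ?_
  rw [Matrix.of_apply, Fin.cons_zero, pBinom, mul_one]
  rfl

end Determinant

section PairProduct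

variable {n : ℕ}

/-- The product of the polynomials of the factors `V_{s,t}` over all pairs `s < t`. -/
def pairProd (Q : K) (w : MvPolynomial (Fin 2) K) (n : ℕ) : MvPolynomial (Fin n) K :=
  ∏ p : Fin n × Fin n with p.1 < p.2, factorPoly Q w p.1 p.2

theorem pairProd_eq_prod_ite (Q : K) (w : MvPolynomial (Fin 2) K) (n : ℕ) :
    pairProd Q w n = ∏ s : Fin n, ∏ t : Fin n, if s < t then factorPoly Q w s t else 1 := by
  rw [pairProd, Finset.prod_filter, ← Finset.univ_product_univ, Finset.prod_product]

theorem list_prod_eq_pairProd (Q : K) (w : MvPolynomial (Fin 2) K) {L : List (Fin n × Fin n)}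
    (hL : L.Nodup) (h : ∀ p, p ∈ L ↔ p.1 < p.2) :
    (L.map fun p => factorPoly Q w p.1 p.2).prod = pairProd Q w n := by
  rw [pairProd, ← List.prod_toFinset _ hL]
  refine Finset.prod_congr (Finset.ext fun p => ?_) fun _ _ => rfl
  rw [List.mem_toFinset, h, Finset.mem_filter_univ]

theorem rename_swap_pairProd (Q : K) (w : MvPolynomial (Fin 2) K) {i j : Fin n}
    (hij : (j : ℕ) = i + 1) :
    rename (Equiv.swap i j) (factorPoly Q w j i * pairProd Q w n)
      = factorPoly Q w j i * pairProd Q w n := by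
  have hinsert : factorPoly Q w j i * pairProd Q w n
      = ∏ p ∈ insert (j, i) (Finset.univ.filter fun p : Fin n × Fin n => p.1 < p.2),
        factorPoly Q w p.1 p.2 := by
    rw [Finset.prod_insert (by simp [Fin.le_def, hij]), pairProd]
  rw [hinsert, map_prod]
  simp only [rename_factorPoly]
  refine Finset.prod_equiv ((Equiv.swap i j).prodCongr (Equiv.swap i j)) (fun p => ?_)
    fun p _ => rfl
  obtain ⟨s, t⟩ := p
  simp only [Finset.mem_insert, Finset.mem_filter, Finset.mem_univ, true_and, Prod.mk.injEq,
    Equiv.prodCongr_apply, Prod.map_apply, Equiv.swap_apply_def, Fin.lt_def, Fin.ext_iff]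
  split_ifs <;> simp_all <;> omega

-- In characteristic `2`, antisymmetry alone does not force the values on the diagonal `x i = x j`
-- to vanish; hence `F` is written as `G - G ∘ swap`, where `G` is the part of `F` on `x i < x j`.
theorem act_eq_zero_of_antisymm {ι : Type*} [DecidableEq ι] (P : K) {i j : ι}
    {p : MvPolynomial ι K} (hp : rename (Equiv.swap i j) p = p) {F : (ι → ℤ) → K}
    (hF_swap : ∀ x, F (x ∘ Equiv.swap i j) = -F x) (hF : ∀ x, x i = x j → F x = 0) {x : ι → ℤ}
    (hx : x i = x j) : act P p F x = 0 := by
  let G : (ι → ℤ) → K := fun y => if y i < y j then F y else 0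
  have hFG : F = G - G ∘ fun y => y ∘ Equiv.swap i j := by
    ext y
    simp only [G, Pi.sub_apply, Function.comp_apply, Equiv.swap_apply_left,
      Equiv.swap_apply_right, hF_swap]
    rcases lt_trichotomy (y i) (y j) with h | h | h
    · rw [if_pos h, if_neg h.asymm, sub_zero]
    · rw [if_neg h.not_lt, if_neg h.not_gt, hF y h, sub_zero]
    · rw [if_neg h.asymm, if_pos h, zero_sub, neg_neg]
  have hcomp := act_comp_rename P (fun y : ι → ℤ => y ∘ Equiv.swap i j) (Equiv.swap i j)
    (fun y a => congrArg y (Equiv.swap_apply_self i j a))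
    (fun y a v => by rw [Function.update_comp_equiv, Equiv.symm_swap]) p G
  have hx_swap : x ∘ Equiv.swap i j = x := by
    ext a
    rw [Function.comp_apply, Equiv.apply_swap_eq_self hx]
  rw [hFG, map_sub, Pi.sub_apply, hcomp, hp, Function.comp_apply, hx_swap, sub_self]

theorem vanishesOnAdjacent_act_pairProd (P Q : K) (w : MvPolynomial (Fin 2) K) (d : Fin n → ℕ) :
    VanishesOnAdjacent P Q w (act P (pairProd Q w n) (detBinom P d)) := by
  intro i j hij x hx
  have hne : i ≠ j := by rintro rfl; omega
  rw [← act_mul]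
  exact act_eq_zero_of_antisymm P (rename_swap_pairProd Q w hij) (detBinom_comp_swap P d hne)
    (fun y => detBinom_eq_zero P d hne) hx

/-- Setting the variable `X r` to zero. -/
def dropVar (K : Type*) [Field K] (r : Fin (n + 1)) :
    MvPolynomial (Fin (n + 1)) K →ₐ[K] MvPolynomial (Fin n) K :=
  aeval (Fin.insertNth (α := fun _ => MvPolynomial (Fin n) K) r 0 X)

theorem dropVar_X_self (r : Fin (n + 1)) : dropVar K r (X r) = 0 := by
  rw [dropVar, aeval_X, Fin.insertNth_apply_same]

theorem dropVar_X_succAbove (r : Fin (n + 1)) (i : Fin n) :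
    dropVar K r (X (r.succAbove i)) = X i := by
  rw [dropVar, aeval_X, Fin.insertNth_apply_succAbove]

theorem dropVar_C (r : Fin (n + 1)) (c : K) : dropVar K r (C c) = C c :=
  (dropVar K r).commutes c

theorem dropVar_rename_succAbove (r : Fin (n + 1)) (p : MvPolynomial (Fin n) K) :
    dropVar K r (rename r.succAbove p) = p := by
  have hcomp : (dropVar K r).comp (rename r.succAbove) = AlgHom.id K _ :=
    algHom_ext fun i => by
      rw [AlgHom.comp_apply, rename_X, dropVar_X_succAbove, AlgHom.id_apply]
  exact DFunLike.congr_fun hcomp p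

theorem act_comp_succAbove (P : K) (r : Fin (n + 1)) (p : MvPolynomial (Fin (n + 1)) K)
    (F : (Fin n → ℤ) → K) :
    act P p (F ∘ fun k : Fin (n + 1) → ℤ => k ∘ r.succAbove)
      = act P (dropVar K r p) F ∘ fun k : Fin (n + 1) → ℤ => k ∘ r.succAbove := by
  refine act_comp_of_pDelta_comp P _ _ (fun i F => ?_) p F
  ext k
  rcases Fin.eq_self_or_eq_succAbove r i with rfl | ⟨i, rfl⟩
  · have hupdate : Function.update k i (k i + 1) ∘ i.succAbove = k ∘ i.succAbove :=
      Function.update_comp_eq_of_forall_ne _ _ (Fin.succAbove_ne i)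
    simp only [dropVar_X_self, map_zero, LinearMap.zero_apply, pDelta, shift, Function.comp_apply,
      hupdate, sub_self, mul_zero, Pi.zero_apply]
  · simp only [dropVar_X_succAbove, act_X, pDelta, shift, Function.comp_apply,
      Function.update_comp_eq_of_injective _ Fin.succAbove_right_injective]

theorem dropVar_factorPoly_left (Q : K) (w : MvPolynomial (Fin 2) K) (r : Fin (n + 1))
    (i : Fin n) :
    dropVar K r (factorPoly Q w r (r.succAbove i)) = C Q * shiftFactor Q i := by
  simp only [factorPoly, shiftFactor, idFactor, map_sub, map_mul, map_add, dropVar_X_self,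
    dropVar_X_succAbove, dropVar_C]
  ring

theorem dropVar_factorPoly_right (Q : K) (w : MvPolynomial (Fin 2) K) (r : Fin (n + 1))
    (i : Fin n) :
    dropVar K r (factorPoly Q w (r.succAbove i) r) = C Q * idFactor Q i := by
  simp only [factorPoly, shiftFactor, idFactor, map_sub, map_mul, map_add, dropVar_X_self,
    dropVar_X_succAbove, dropVar_C]
  ring

theorem dropVar_factorPoly_succAbove (Q : K) (w : MvPolynomial (Fin 2) K) (r : Fin (n + 1))
    (i j : Fin n) :
    dropVar K r (factorPoly Q w (r.succAbove i) (r.succAbove j)) = factorPoly Q w i j := by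
  rw [← rename_factorPoly, dropVar_rename_succAbove]

theorem dropVar_factorPoly_ite (Q : K) (w : MvPolynomial (Fin 2) K) (r : Fin (n + 1))
    (i : Fin n) :
    dropVar K r (if r < r.succAbove i then factorPoly Q w r (r.succAbove i) else 1) *
        dropVar K r (if r.succAbove i < r then factorPoly Q w (r.succAbove i) r else 1)
      = C Q * if i.castSucc < r then idFactor Q i else shiftFactor Q i := by
  rcases lt_or_ge i.castSucc r with h | h
  · have hlt : r.succAbove i < r := by rwa [Fin.succAbove_lt_iff_castSucc_lt]
    rw [if_neg hlt.asymm, if_pos hlt, if_pos h, map_one, one_mul, dropVar_factorPoly_right]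
  · have hlt : r < r.succAbove i := by rwa [Fin.lt_succAbove_iff_le_castSucc]
    rw [if_pos hlt, if_neg hlt.asymm, if_neg h.not_gt, map_one, mul_one, dropVar_factorPoly_left]

theorem dropVar_pairProd (Q : K) (w : MvPolynomial (Fin 2) K) (r : Fin (n + 1)) :
    dropVar K r (pairProd Q w (n + 1)) = C Q ^ n * splitFactor Q r * pairProd Q w n := by
  have hrest : ∀ i j, dropVar K r (if r.succAbove i < r.succAbove j
      then factorPoly Q w (r.succAbove i) (r.succAbove j) else 1)
        = if i < j then factorPoly Q w i j else 1 := fun i j => by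
    simp only [Fin.succAbove_lt_succAbove_iff, apply_ite (dropVar K r),
      dropVar_factorPoly_succAbove, map_one]
  have hconst : (C Q : MvPolynomial (Fin n) K) ^ n = ∏ _i : Fin n, C Q := by
    rw [Finset.prod_const, Finset.card_univ, Fintype.card_fin]
  rw [pairProd_eq_prod_ite, Fin.prod_univ_succAbove _ r, Fin.prod_univ_succAbove _ r,
    if_neg (lt_irrefl r), one_mul]
  simp only [Fin.prod_univ_succAbove _ r, Finset.prod_mul_distrib, map_mul, map_prod, hrest]
  rw [← mul_assoc, ← Finset.prod_mul_distrib, ← pairProd_eq_prod_ite]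
  simp only [dropVar_factorPoly_ite]
  rw [Finset.prod_mul_distrib, ← hconst, splitFactor]

theorem act_pairProd_detBinom_cons_zero (P Q : K) (w : MvPolynomial (Fin 2) K) (d : Fin n → ℕ)
    (k : Fin (n + 1) → ℤ) :
    act P (pairProd Q w (n + 1)) (detBinom P (Fin.cons (α := fun _ => ℕ) 0 d)) k
      = Q ^ n * splitSum P Q k (act P (pairProd Q w n) (detBinom P d)) := by
  have hdet : detBinom P (Fin.cons (α := fun _ => ℕ) 0 d) = ∑ r : Fin (n + 1), (-1 : K) ^ (r : ℕ) •
      (detBinom P d ∘ fun k : Fin (n + 1) → ℤ => k ∘ r.succAbove) := by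
    ext k
    rw [detBinom_cons_zero, Finset.sum_apply]
    rfl
  rw [hdet, map_sum, Finset.sum_apply, splitSum_apply, Finset.mul_sum]
  refine Finset.sum_congr rfl fun r _ => ?_
  rw [map_smul, act_comp_succAbove, dropVar_pairProd, act_mul, act_mul, ← C_pow, act_C]
  simp only [Pi.smul_apply, Function.comp_apply, smul_eq_mul]
  ring

theorem sumOp_smul_act_pairProd {P Q : K} (hP : P ≠ 0) (hQ : Q ≠ 0) {R : ℕ}
    (S : Finset (ℤ × ℤ)) (f : S → K) {d : Fin n → ℕ} (hd : ∀ j, d j + 1 < R) (c : K)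
    (k : Fin (n + 1) → ℤ) :
    sumOp P Q S f n (c • act P (pairProd Q (laurentPoly R S f) n) (detBinom P d)) k
      = c * P ^ (∑ j, d j) * (Q ^ n)⁻¹ * act P (pairProd Q (laurentPoly R S f) (n + 1))
          (detBinom P (Fin.cons (α := fun _ => ℕ) 0 fun j => d j + 1)) k := by
  set V := pairProd Q (laurentPoly R S f) n
  set F := (c * P ^ (∑ j, d j)) • act P V (detBinom P fun j => d j + 1) with hF
  have hA : c • act P V (detBinom P d) = act P (∏ j, X j) F := by
    rw [hF, map_smul, act_comm, act_prod_X_detBinom hP, map_smul, smul_smul, mul_assoc, zpow_neg,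
      zpow_natCast, mul_inv_cancel₀ (pow_ne_zero _ hP), mul_one]
  have hmem : F ∈ degreeLT (Fin n) P R :=
    Submodule.smul_mem _ _ (act_mem_degreeLT (detBinom_mem_degreeLT hP hd) V)
  have hvanish : VanishesOnAdjacent P Q (laurentPoly R S f) F := fun i j hij x hx => by
    rw [hF, map_smul, Pi.smul_apply, vanishesOnAdjacent_act_pairProd P Q _ _ i j hij x hx,
      smul_zero]
  rw [hA, sumOp_act_prod_X hP hQ S f n hmem hvanish, hF, map_smul, smul_eq_mul,
    act_pairProd_detBinom_cons_zero, mul_assoc, mul_assoc, mul_assoc,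
    inv_mul_cancel_left₀ (pow_ne_zero _ hQ)]

end PairProduct

section Alpha

/-- The lower indices of the `P`-binomial coefficients in `binomDet`. -/
def binomIndex (n m : ℕ) (j : Fin n) : ℕ := (j : ℕ) + if (j : ℕ) + 1 = n then m else 0

theorem binomDet_eq_detBinom (P : K) (n m : ℕ) : binomDet P n m = detBinom P (binomIndex n m) :=
  rfl

theorem binomIndex_lt (n m : ℕ) (j : Fin n) : binomIndex n m j < n + m := by
  unfold binomIndex
  split_ifs <;> omega

theorem cons_zero_binomIndex (n m : ℕ) :
    Fin.cons (α := fun _ => ℕ) 0 (fun j => binomIndex (n + 1) m j + 1) = binomIndex (n + 2) m := by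
  ext j
  refine Fin.cases ?_ (fun j => ?_) j
  · simp [binomIndex]
  · simp only [Fin.cons_succ, binomIndex, Fin.val_succ, add_left_inj]
    omega

theorem sum_binomIndex (n m : ℕ) : ∑ j, binomIndex (n + 1) m j = (n + 1).choose 2 + m := by
  have hcastSucc : ∀ j : Fin n, binomIndex (n + 1) m j.castSucc = j := fun j => by
    simp [binomIndex, j.2.ne]
  have hlast : binomIndex (n + 1) m (Fin.last n) = n + m := by simp [binomIndex]
  rw [Fin.sum_univ_castSucc, hlast, Finset.sum_congr rfl fun j _ => hcastSucc j,
    Fin.sum_univ_eq_sum_range (fun i => i), Finset.sum_range_id, ← Nat.choose_two_right,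
    Nat.choose_succ_succ' n 1, Nat.choose_one_right]
  ring

theorem alpha_eq_act {P Q : K} (hP : P ≠ 0) (hQ : Q ≠ 0) (m : ℕ) (S : Finset (ℤ × ℤ)) (f : S → K)
    {R n : ℕ} (hR : n + 1 + m ≤ R) :
    alpha P Q m S f (n + 1)
      = (P ^ ((n + 1).choose 3 + m * n) * (Q ^ (n + 1).choose 2)⁻¹) •
        act P (pairProd Q (laurentPoly R S f) (n + 1)) (binomDet P (n + 1) m) := by
  induction n with
  | zero =>
    ext k
    simp [alpha, binomDet, pairProd_eq_prod_ite, Nat.choose]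
  | succ n ih =>
    have hd : ∀ j, binomIndex (n + 1) m j + 1 < R := fun j => by
      have := binomIndex_lt (n + 1) m j
      omega
    have hchoose3 : (n + 1 + 1).choose 3 = (n + 1).choose 2 + (n + 1).choose 3 :=
      Nat.choose_succ_succ' _ _
    have hchoose2 : (n + 1 + 1).choose 2 = (n + 1) + (n + 1).choose 2 := by
      rw [Nat.choose_succ_succ' _ 1, Nat.choose_one_right]
    ext k
    rw [alpha, ih (by omega), binomDet_eq_detBinom, sumOp_smul_act_pairProd hP hQ S f hd,
      cons_zero_binomIndex, sum_binomIndex, binomDet_eq_detBinom, Pi.smul_apply, smul_eq_mul,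
      hchoose3, hchoose2]
    ring

end Alpha

section Vandermonde

theorem prod_prod_Ioi_eq_prod_prod_range {M : Type*} [CommMonoid M] (n : ℕ) (g : ℕ → ℕ → M) :
    ∏ i : Fin n, ∏ j ∈ Finset.Ioi i, g i j = ∏ j : Fin n, ∏ i ∈ Finset.range j, g i j := by
  rw [Finset.prod_comm' (t' := Finset.univ) (s' := Finset.Iio) (by simp)]
  refine Finset.prod_congr rfl fun j _ => ?_
  rw [← Nat.Iio_eq_range, ← Fin.map_valEmbedding_Iio, Finset.prod_map]
  rfl

theorem det_prod_range_sub {R : Type*} [CommRing R] {n : ℕ} (v : Fin n → R) (u : ℕ → R) :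
    Matrix.det (Matrix.of fun i j : Fin n => ∏ a ∈ Finset.range j, (v i - u a))
      = ∏ i : Fin n, ∏ j ∈ Finset.Ioi i, (v j - v i) := by
  nontriviality R
  rw [← Matrix.det_vandermonde, Matrix.det_eval_matrixOfPolynomials_eq_det_vandermonde v
    (fun j => ∏ a ∈ Finset.range j, (Polynomial.X - Polynomial.C (u a)))]
  · simp only [Polynomial.eval_prod, Polynomial.eval_sub, Polynomial.eval_X, Polynomial.eval_C]
  · intro j
    rw [Polynomial.natDegree_prod_of_monic _ _ fun a _ => Polynomial.monic_X_sub_C _]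
    simp only [Polynomial.natDegree_X_sub_C, Finset.sum_const, Finset.card_range, smul_eq_mul,
      mul_one]
  · exact fun j => Polynomial.monic_prod_of_monic _ _ fun a _ => Polynomial.monic_X_sub_C _

theorem binomDet_eq_prod_div {P : K} {n : ℕ} {k : Fin n → ℤ} (v : Fin n → K) (u : ℕ → K)
    (h : ∀ i, ∀ j < n, pBinom P (k i) j = ∏ a ∈ Finset.range j, (v i - u a) / (u j - u a)) :
    binomDet P n 0 k = ∏ i : Fin n, ∏ j ∈ Finset.Ioi i, (v j - v i) / (u j - u i) := by
  simp only [Finset.prod_div_distrib]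
  rw [← det_prod_range_sub v u, prod_prod_Ioi_eq_prod_prod_range n fun i j => u j - u i,
    div_eq_inv_mul, ← Finset.prod_inv_distrib, ← Matrix.det_mul_row, binomDet]
  congr 1
  ext i j
  rw [Matrix.of_apply, Matrix.of_apply, Matrix.of_apply, ite_self, add_zero, h i j j.2,
    Finset.prod_div_distrib, div_eq_inv_mul]

theorem pBinom_eq_prod_sub_div {P : K} (hP : P ≠ 0) {m : ℕ}
    (hm : ∀ d : ℕ, 0 < d → d ≤ m → P ^ d ≠ 1) (x : ℤ) :
    pBinom P x m = ∏ a ∈ Finset.range m, (P ^ x - P ^ a) / (P ^ m - P ^ a) := by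
  rw [pBinom_eq_div P hP m hm, ← Finset.prod_range_reflect fun i => 1 - P ^ (i + 1),
    ← Finset.prod_div_distrib]
  refine Finset.prod_congr rfl fun a ha => ?_
  have ha' : m - 1 - a + 1 = m - a := by rw [Finset.mem_range] at ha; omega
  have hnum : -P ^ a * (1 - P ^ (x - a)) = P ^ x - P ^ a := by
    rw [zpow_sub₀ hP, zpow_natCast]
    field_simp
    ring
  have hden : -P ^ a * (1 - P ^ (m - a)) = P ^ m - P ^ a := by
    rw [← Nat.add_sub_of_le (Finset.mem_range.1 ha).le, pow_add, Nat.add_sub_cancel_left]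
    ring
  rw [ha', ← mul_div_mul_left _ _ (neg_ne_zero.2 (pow_ne_zero a hP)), hnum, hden]

theorem binomDet_eq_pVandermonde {P : K} (hP : P ≠ 0) {n : ℕ}
    (hn : ∀ d : ℕ, 0 < d → d < n → P ^ d ≠ 1) (k : Fin n → ℤ) :
    binomDet P n 0 k = P ^ n.choose 2 * pVandermonde P n k := by
  have hpow : P ^ n.choose 2 = ∏ i : Fin n, ∏ _j ∈ Finset.Ioi i, P := by
    rw [prod_prod_Ioi_eq_prod_prod_range n fun _ _ => P]
    simp only [Finset.prod_const, Finset.card_range, Finset.prod_pow_eq_pow_sum]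
    rw [Fin.sum_univ_eq_sum_range fun i => i, Finset.sum_range_id, Nat.choose_two_right]
  rw [binomDet_eq_prod_div (fun i => P ^ k i) (fun j => P ^ j) fun i j hj =>
    pBinom_eq_prod_sub_div hP (fun d hd hdj => hn d hd (by omega)) (k i), hpow, pVandermonde]
  simp only [← Finset.prod_mul_distrib, pow_succ', ← mul_sub, ← mul_div_assoc,
    mul_div_mul_left _ _ hP]

theorem pBinom_one_eq_prod_sub_div {m : ℕ} (hm : ∀ d : ℕ, 0 < d → d ≤ m → (d : K) ≠ 0) (x : ℤ) :
    pBinom (1 : K) x m = ∏ a ∈ Finset.range m, ((x : K) - a) / ((m : K) - a) := by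
  have hdesc : (descPochhammer ℤ m).eval x = (m.factorial : ℤ) * Ring.choose x m := by
    rw [Polynomial.eval_eq_smeval, Ring.descPochhammer_eq_factorial_smul_choose, nsmul_eq_mul]
  have hnum : ∏ a ∈ Finset.range m, ((x : K) - a) = m.factorial * (Ring.choose x m : ℤ) := by
    rw [← Int.cast_natCast, ← Int.cast_mul, ← hdesc, descPochhammer_eval_eq_prod_range]
    push_cast
    rfl
  have hden : ∏ a ∈ Finset.range m, ((m : K) - a) = m.factorial := by
    rw [← descPochhammer_eval_eq_prod_range, descPochhammer_eval_eq_descFactorial,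
      Nat.descFactorial_self]
  have hne : (m.factorial : K) ≠ 0 := by
    rw [← hden, Finset.prod_ne_zero_iff]
    intro a ha
    rw [Finset.mem_range] at ha
    rw [← Nat.cast_sub ha.le]
    exact hm _ (by omega) (by omega)
  rw [pBinom_one, Finset.prod_div_distrib, hnum, hden, mul_div_cancel_left₀ _ hne]

theorem binomDet_one_eq_vandermonde {n : ℕ} (hn : ∀ d : ℕ, 0 < d → d < n → (d : K) ≠ 0)
    (k : Fin n → ℤ) : binomDet (1 : K) n 0 k = vandermonde K n k :=
  binomDet_eq_prod_div (fun i => (k i : K)) (fun j => (j : K)) fun i j hj =>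
    pBinom_one_eq_prod_sub_div (fun d hd hdj => hn d hd (by omega)) (k i)

end Vandermonde

section MonotoneTriangles

variable {n : ℕ}

open scoped Classical in
/-- The strictly increasing rows that interlace with the row `k`: the rows that may stand on top of
`k` in a monotone triangle. -/
def interlacing (k : Fin (n + 1) → ℤ) : Finset (Fin n → ℤ) :=
  (Fintype.piFinset fun i => Finset.Icc (k i.castSucc) (k i.succ)).filter StrictMono

theorem mem_interlacing {k : Fin (n + 1) → ℤ} {l : Fin n → ℤ} :
    l ∈ interlacing k ↔ (∀ i, k i.castSucc ≤ l i ∧ l i ≤ k i.succ) ∧ StrictMono l := by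
  simp [interlacing]

theorem strictMono_snoc {l : Fin (n + 1) → ℤ} {x : ℤ} :
    StrictMono (Fin.snoc (α := fun _ => ℤ) l x : Fin (n + 2) → ℤ)
      ↔ StrictMono l ∧ l (Fin.last n) < x := by
  rw [Fin.strictMono_iff_lt_succ, Fin.strictMono_iff_lt_succ, Fin.forall_fin_succ']
  refine and_congr (forall_congr' fun i => ?_) ?_
  · rw [Fin.snoc_castSucc, Fin.succ_castSucc, Fin.snoc_castSucc]
  · rw [Fin.snoc_castSucc, Fin.succ_last, Fin.snoc_last]

theorem snoc_mem_interlacing {k : Fin (n + 3) → ℤ} {l : Fin (n + 1) → ℤ} {x : ℤ} :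
    (Fin.snoc (α := fun _ => ℤ) l x : Fin (n + 2) → ℤ) ∈ interlacing k
      ↔ l ∈ interlacing (Fin.init k : Fin (n + 2) → ℤ) ∧
        x ∈ Finset.Icc (k (Fin.last (n + 1)).castSucc) (k (Fin.last (n + 2))) ∧
        l (Fin.last n) < x := by
  rw [mem_interlacing, mem_interlacing, strictMono_snoc, Fin.forall_fin_succ', Finset.mem_Icc]
  simp only [Fin.snoc_castSucc, Fin.snoc_last, Fin.succ_last, Fin.init, Fin.succ_castSucc]
  tauto

theorem snoc_last_mem_interlacing {k : Fin (n + 2) → ℤ} (hk : StrictMono k) {l : Fin n → ℤ} :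
    (Fin.snoc (α := fun _ => ℤ) l (k (Fin.last (n + 1))) : Fin (n + 1) → ℤ) ∈ interlacing k
      ↔ l ∈ interlacing (Fin.init k : Fin (n + 1) → ℤ) := by
  rcases n with _ | n
  · have hsnoc : ∀ i, k (Fin.castSucc i)
        ≤ (Fin.snoc (α := fun _ => ℤ) l (k (Fin.last 1)) : Fin 1 → ℤ) i ∧
        (Fin.snoc (α := fun _ => ℤ) l (k (Fin.last 1)) : Fin 1 → ℤ) i ≤ k i.succ := fun i => by
      obtain rfl : i = Fin.last 0 := Fin.fin_one_eq_zero i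
      rw [Fin.snoc_last, Fin.succ_last]
      exact ⟨hk.monotone (Fin.le_last _), le_rfl⟩
    exact iff_of_true (mem_interlacing.2 ⟨hsnoc, Subsingleton.strictMono (α := Fin 1) _⟩)
      (mem_interlacing.2 ⟨fun i => i.elim0, Subsingleton.strictMono _⟩)
  · rw [snoc_mem_interlacing]
    refine ⟨And.left, fun h => ⟨h, Finset.mem_Icc.2 ⟨hk.monotone (Fin.le_last _), le_rfl⟩, ?_⟩⟩
    exact ((mem_interlacing.1 h).1 (Fin.last n)).2.trans_lt (hk (Fin.castSucc_lt_last _))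

theorem sum_filter_lt_eq_sum_interlacing (k : Fin (n + 3) → ℤ) (g : (Fin (n + 2) → ℤ) → K) :
    ∑ p ∈ Finset.Icc (k (Fin.last (n + 1)).castSucc) (k (Fin.last (n + 2))) ×ˢ
        interlacing (Fin.init k : Fin (n + 2) → ℤ) with p.2 (Fin.last n) < p.1,
      g (Fin.snoc p.2 p.1) = ∑ l ∈ interlacing k, g l := by
  refine Finset.sum_equiv (Fin.snocEquiv fun _ => ℤ) (fun p => ?_) fun _ _ => rfl
  rw [Finset.mem_filter, Finset.mem_product, and_assoc, and_left_comm]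
  exact snoc_mem_interlacing.symm

theorem sum_filter_not_lt_eq_sum_interlacing {k : Fin (n + 3) → ℤ} (hk : StrictMono k)
    (g : (Fin (n + 2) → ℤ) → K) :
    ∑ p ∈ Finset.Icc (k (Fin.last (n + 1)).castSucc) (k (Fin.last (n + 2))) ×ˢ
        interlacing (Fin.init k : Fin (n + 2) → ℤ) with ¬ p.2 (Fin.last n) < p.1,
      g (Fin.snoc p.2 p.1)
      = ∑ l ∈ interlacing (Fin.init (Fin.init k : Fin (n + 2) → ℤ) : Fin (n + 1) → ℤ),
        g (Fin.snoc (α := fun _ => ℤ)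
          (Fin.snoc (α := fun _ => ℤ) l (k (Fin.last (n + 1)).castSucc))
          (k (Fin.last (n + 1)).castSucc)) := by
  set c := k (Fin.last (n + 1)).castSucc
  have hinit : StrictMono (Fin.init k : Fin (n + 2) → ℤ) := hk.comp Fin.strictMono_castSucc
  have hmem : ∀ l : Fin n → ℤ, (Fin.snoc (α := fun _ => ℤ) l c : Fin (n + 1) → ℤ)
      ∈ interlacing (Fin.init k : Fin (n + 2) → ℤ) ↔ l ∈ interlacing (Fin.init (Fin.init k)) :=
    fun l => snoc_last_mem_interlacing hinit
  have hsnoc : ∀ p ∈ (Finset.Icc c (k (Fin.last (n + 2))) ×ˢ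
      interlacing (Fin.init k : Fin (n + 2) → ℤ)).filter (fun p => ¬ p.2 (Fin.last n) < p.1),
      (c, Fin.snoc (α := fun _ => ℤ) (Fin.init p.2 : Fin n → ℤ) c) = p := by
    rintro ⟨x, l⟩ h
    rw [Finset.mem_filter, Finset.mem_product, Finset.mem_Icc, mem_interlacing, not_lt] at h
    obtain ⟨⟨⟨hcx, -⟩, hl, -⟩, hxl⟩ := h
    have hlc : l (Fin.last n) ≤ c := (hl (Fin.last n)).2
    obtain rfl : x = c := le_antisymm (hxl.trans hlc) hcx
    rw [Prod.mk_right_inj, ← hlc.antisymm hxl, Fin.snoc_init_self]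
  refine Finset.sum_nbij' (fun p => (Fin.init p.2 : Fin n → ℤ))
    (fun l => (c, Fin.snoc (α := fun _ => ℤ) l c)) (fun p hp => ?_) (fun l hl => ?_) hsnoc
    (fun l _ => Fin.init_snoc _ _)
    fun p hp => congrArg (fun p : ℤ × (Fin (n + 1) → ℤ) => g (Fin.snoc p.2 p.1)) (hsnoc p hp).symm
  · rw [← hmem, show Fin.snoc (α := fun _ => ℤ) (Fin.init p.2) c = p.2 from
      congrArg Prod.snd (hsnoc p hp)]
    exact (Finset.mem_product.1 (Finset.mem_filter.1 hp).1).2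
  · rw [Finset.mem_filter, Finset.mem_product, Finset.mem_Icc]
    exact ⟨⟨⟨le_rfl, hk.monotone (Fin.le_last _)⟩, (hmem l).2 hl⟩, by simp⟩

theorem mainTerm_one_one (G : ℤ → K) {a b : ℤ} (h : b ≤ a) :
    mainTerm 1 1 G a b = ∑ x ∈ Finset.Icc b a, G x := by
  have hH : ∀ x, signedSum b (x + 1 - 1) G = signedSum b (x - 1) G + 1 ^ x * G x := fun x => by
    rw [one_zpow, one_mul, add_sub_cancel_right, signedSum_eq_add]
  have hempty : signedSum b (b - 1) G = 0 := by simp [signedSum]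
  have hIcc : signedSum b a G = ∑ x ∈ Finset.Icc b a, G x := if_pos h
  rw [mainTerm_eq_sub one_ne_zero one_ne_zero (H := fun x => signedSum b (x - 1) G) hH, hempty,
    ← hIcc, signedSum_eq_add b a]
  ring

theorem laurentOp_singleton_zero {ι : Type*} [DecidableEq ι] (P : K)
    (f : ({((0 : ℤ), (0 : ℤ))} : Finset (ℤ × ℤ)) → K) (s t : ι) (F : (ι → ℤ) → K) :
    laurentOp P {((0 : ℤ), (0 : ℤ))} f s t F = f ⟨(0, 0), Finset.mem_singleton_self _⟩ • F :=
  Fintype.sum_unique _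

theorem sumOp_one_one_eq_sum_interlacing : ∀ {n : ℕ} (A : (Fin n → ℤ) → K) {k : Fin (n + 1) → ℤ}
    (_ : StrictMono k),
    sumOp 1 1 {((0 : ℤ), (0 : ℤ))} (fun _ => -1) n A k = ∑ l ∈ interlacing k, A l
  | 0, A, k, _ => by
    have huniv : interlacing k = {![]} := Finset.eq_singleton_iff_unique_mem.2
      ⟨mem_interlacing.2 ⟨fun i => i.elim0, Subsingleton.strictMono _⟩,
        fun l _ => Subsingleton.elim _ _⟩
    rw [huniv, Finset.sum_singleton, sumOp]
  | 1, A, k, hk => by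
    rw [sumOp, mainTerm_one_one _ (hk.monotone (Fin.zero_le 1))]
    refine Finset.sum_equiv (Equiv.funUnique (Fin 1) ℤ).symm (fun x => ?_) fun x _ => ?_
    · rw [Finset.mem_Icc, mem_interlacing, and_iff_left (Subsingleton.strictMono _),
        Fin.forall_fin_one]
      rfl
    · rw [sumOp]
      congr 1
  | n + 2, A, k, hk => by
    have hinit : StrictMono (Fin.init k : Fin (n + 2) → ℤ) := hk.comp Fin.strictMono_castSucc
    have hinit' : StrictMono (Fin.init (Fin.init k : Fin (n + 2) → ℤ) : Fin (n + 1) → ℤ) :=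
      hinit.comp Fin.strictMono_castSucc
    rw [sumOp, mainTerm_one_one _ (hk.monotone (Fin.le_last _)),
      sumOp_one_one_eq_sum_interlacing _ hinit']
    simp only [sumOp_one_one_eq_sum_interlacing _ hinit, laurentOp_singleton_zero, neg_one_smul,
      Pi.neg_apply, Matrix.cons_val_zero, Matrix.cons_val_one, Finset.sum_neg_distrib]
    rw [← sub_eq_add_neg, sub_eq_iff_eq_add, ← Finset.sum_product',
      ← sum_filter_lt_eq_sum_interlacing, ← sum_filter_not_lt_eq_sum_interlacing hk,
      Finset.sum_filter_add_sum_filter_not]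

/-- The indices of a triangle with `n` rows. -/
abbrev TriIndex (n : ℕ) : Type := {p : Fin n × Fin n // p.1 ≤ p.2}

namespace TriIndex

/-- The `j`-th index of the bottom row. -/
def bottom (j : Fin (n + 1)) : TriIndex (n + 1) :=
  ⟨(0, j), j.zero_le⟩

/-- The embedding of the triangle with `n` rows above the bottom row of the next larger one. -/
def succ (p : TriIndex n) : TriIndex (n + 1) :=
  ⟨(p.1.1.succ, p.1.2.succ), Fin.succ_le_succ_iff.2 p.2⟩

/-- Induction on whether an index lies in the bottom row. -/
@[elab_as_elim]
def cases {motive : TriIndex (n + 1) → Sort*} (bottom : ∀ j, motive (bottom j))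
    (succ : ∀ p, motive (succ p)) : ∀ p, motive p
  | ⟨(⟨0, _⟩, j), _⟩ => bottom j
  | ⟨(⟨i + 1, hi⟩, ⟨j + 1, hj⟩), hij⟩ =>
    succ ⟨(⟨i, Nat.lt_of_succ_lt_succ hi⟩, ⟨j, Nat.lt_of_succ_lt_succ hj⟩),
      Nat.le_of_succ_le_succ hij⟩

end TriIndex

/-- The triangle obtained from `a` by adding the bottom row `k`. -/
def addRow (k : Fin (n + 1) → ℤ) (a : TriIndex n → ℤ) : TriIndex (n + 1) → ℤ :=
  TriIndex.cases k a

/-- The row above the bottom row of a triangle. -/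
def secondRow (a : TriIndex (n + 2) → ℤ) (j : Fin (n + 1)) : ℤ :=
  a (TriIndex.bottom j).succ

theorem secondRow_mem_interlacing {k : Fin (n + 2) → ℤ} {a : TriIndex (n + 2) → ℤ}
    (ha : IsMonotoneTriangle k a) : secondRow a ∈ interlacing k := by
  refine mem_interlacing.2 ⟨fun j => ⟨?_, ?_⟩, Fin.strictMono_iff_lt_succ.2 fun j => ?_⟩
  · exact (ha.bottom (TriIndex.bottom j.castSucc) rfl).ge.trans (ha.northeast _ _ rfl rfl)
  · exact (ha.southeast (TriIndex.bottom j).succ (TriIndex.bottom j.succ) rfl rfl).trans_eq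
      (ha.bottom _ rfl)
  · exact ha.strict _ _ rfl rfl

theorem isMonotoneTriangle_comp_succ {k : Fin (n + 2) → ℤ} {a : TriIndex (n + 2) → ℤ}
    (ha : IsMonotoneTriangle k a) :
    IsMonotoneTriangle (secondRow a) (a ∘ TriIndex.succ) where
  northeast _ _ h1 h2 := ha.northeast _ _ (congrArg (· + 1) h1) (congrArg (· + 1) h2)
  southeast _ _ h1 h2 := ha.southeast _ _ (congrArg (· + 1) h1) (congrArg Fin.succ h2)
  strict _ _ h1 h2 := ha.strict _ _ (congrArg Fin.succ h1) (congrArg (· + 1) h2)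
  bottom p hp := by
    cases p using TriIndex.cases with
    | bottom j => rfl
    | succ p => exact absurd hp (Nat.succ_ne_zero _)

theorem isMonotoneTriangle_addRow {k : Fin (n + 2) → ℤ} (hk : StrictMono k)
    {l : Fin (n + 1) → ℤ} (hl : l ∈ interlacing k) {a : TriIndex (n + 1) → ℤ}
    (ha : IsMonotoneTriangle l a) : IsMonotoneTriangle k (addRow k a) := by
  have hkl := (mem_interlacing.1 hl).1
  refine ⟨fun p q h1 h2 => ?_, fun p q h1 h2 => ?_, fun p q h1 h2 => ?_, fun p hp => ?_⟩
  · cases q using TriIndex.cases with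
    | bottom j => exact absurd h1.symm (Nat.succ_ne_zero _)
    | succ q =>
      cases p using TriIndex.cases with
      | bottom i =>
        obtain rfl : i = q.1.2.castSucc := Fin.ext (Nat.succ_injective h2).symm
        exact (hkl _).1.trans_eq (ha.bottom q (Nat.succ_injective h1)).symm
      | succ p => exact ha.northeast p q (Nat.succ_injective h1) (Nat.succ_injective h2)
  · cases p using TriIndex.cases with
    | bottom i => exact absurd h1.symm (Nat.succ_ne_zero _)
    | succ p =>
      cases q using TriIndex.cases with
      | bottom j =>
        obtain rfl : j = p.1.2.succ := h2
        exact (ha.bottom p (Nat.succ_injective h1)).trans_le (hkl _).2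
      | succ q => exact ha.southeast p q (Nat.succ_injective h1) (Fin.succ_injective _ h2)
  · cases p using TriIndex.cases with
    | bottom i =>
      cases q using TriIndex.cases with
      | bottom j => exact hk (Fin.lt_def.2 ((Nat.lt_succ_self _).trans_eq h2.symm))
      | succ q => exact absurd h1 (Fin.succ_ne_zero _)
    | succ p =>
      cases q using TriIndex.cases with
      | bottom j => exact absurd h1.symm (Fin.succ_ne_zero _)
      | succ q => exact ha.strict p q (Fin.succ_injective _ h1) (Nat.succ_injective h2)
  · cases p using TriIndex.cases with
    | bottom i => rfl
    | succ p => exact absurd hp (Nat.succ_ne_zero _)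

/-- Removing the bottom row of a monotone triangle, as a bijection onto the pairs of a row
interlacing with it and a monotone triangle with that bottom row. -/
def monotoneTriangleEquiv {k : Fin (n + 2) → ℤ} (hk : StrictMono k) :
    {a // IsMonotoneTriangle k a} ≃ Σ l : interlacing k, {a // IsMonotoneTriangle l.1 a} where
  toFun a := ⟨⟨_, secondRow_mem_interlacing a.2⟩, ⟨_, isMonotoneTriangle_comp_succ a.2⟩⟩
  invFun x := ⟨_, isMonotoneTriangle_addRow hk x.1.2 x.2.2⟩
  left_inv a := by
    refine Subtype.ext (funext fun p => ?_)
    cases p using TriIndex.cases with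
    | bottom j => exact (a.2.bottom (TriIndex.bottom j) rfl).symm
    | succ p => rfl
  right_inv := by
    rintro ⟨⟨l, hl⟩, ⟨a, ha⟩⟩
    obtain rfl : l = fun j => a (TriIndex.bottom j) :=
      funext fun j => (ha.bottom (TriIndex.bottom j) rfl).symm
    rfl

theorem finite_monotoneTriangle : ∀ {n : ℕ} {k : Fin (n + 1) → ℤ}, StrictMono k →
    Finite {a // IsMonotoneTriangle k a}
  | 0, k, _ => by
    refine @Finite.of_subsingleton _ ⟨fun a b => Subtype.ext (funext fun p => ?_)⟩
    rw [a.2.bottom p (by omega), b.2.bottom p (by omega)]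
  | n + 1, k, hk => by
    have hfinite (l : interlacing k) : Finite {a // IsMonotoneTriangle l.1 a} :=
      finite_monotoneTriangle (mem_interlacing.1 l.2).2
    exact Finite.of_equiv _ (monotoneTriangleEquiv hk).symm

theorem isMonotoneTriangle_one (k : Fin 1 → ℤ) (a : TriIndex 1 → ℤ) :
    IsMonotoneTriangle k a ↔ a = fun p => k p.1.2 := by
  refine ⟨fun ha => funext fun p => ha.bottom p (by omega), ?_⟩
  rintro rfl
  exact ⟨fun _ _ _ _ => by omega, fun _ _ _ _ => by omega, fun _ _ _ _ => by omega, fun _ _ => rfl⟩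

theorem card_monotoneTriangle_eq_alpha : ∀ {n : ℕ} {k : Fin (n + 1) → ℤ}, StrictMono k →
    (Nat.card {a // IsMonotoneTriangle k a} : K)
      = alpha (1 : K) 1 0 {((0 : ℤ), (0 : ℤ))} (fun _ => -1) (n + 1) k
  | 0, k, _ => by simp [isMonotoneTriangle_one, alpha, pBinom]
  | n + 1, k, hk => by
    have hfinite (l : interlacing k) : Finite {a // IsMonotoneTriangle l.1 a} :=
      finite_monotoneTriangle (mem_interlacing.1 l.2).2
    rw [Nat.card_congr (monotoneTriangleEquiv hk), Nat.card_sigma, alpha,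
      sumOp_one_one_eq_sum_interlacing _ hk, Nat.cast_sum, ← Finset.sum_coe_sort (interlacing k)]
    exact Finset.sum_congr rfl fun l _ =>
      card_monotoneTriangle_eq_alpha (mem_interlacing.1 l.2).2

end MonotoneTriangles

section Conclusion

variable {P Q : K}

theorem binomDet_mem_degreeLT (hP : P ≠ 0) (n m : ℕ) :
    binomDet P n m ∈ degreeLT (Fin n) P (n + m) :=
  detBinom_mem_degreeLT hP (binomIndex_lt n m)

theorem pDelta_iterate_alpha_eq_zero (hP : P ≠ 0) (hQ : Q ≠ 0) {n : ℕ} (m : ℕ)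
    (S : Finset (ℤ × ℤ)) (f : S → K) (s : Fin (n + 1)) :
    (pDelta P s)^[n + 1 + m] (alpha P Q m S f (n + 1)) = 0 := by
  refine mem_degreeLT.1 ?_ s
  rw [alpha_eq_act hP hQ m S f le_rfl]
  exact Submodule.smul_mem _ _ (act_mem_degreeLT (binomDet_mem_degreeLT hP _ m) _)

theorem alpha_eq_opProd (hP : P ≠ 0) (hQ : Q ≠ 0) {n : ℕ} (m : ℕ) (S : Finset (ℤ × ℤ))
    (f : S → K) {L : List (Fin (n + 1) × Fin (n + 1))} (hL : L.Nodup)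
    (h : ∀ p, p ∈ L ↔ p.1 < p.2) {c : K} (hc : c ≠ 0) {F : (Fin (n + 1) → ℤ) → K}
    (hF : binomDet P (n + 1) m = c • F) (k : Fin (n + 1) → ℤ) :
    alpha P Q m S f (n + 1) k
      = P ^ ((n + 1).choose 3 + m * n) * c * Q ^ (-((n + 1).choose 2 : ℤ)) *
        opProd (factorOp P Q S f) L F k := by
  have hmem : F ∈ degreeLT (Fin (n + 1)) P (n + 1 + m) :=
    (Submodule.smul_mem_iff _ hc).1 (hF ▸ binomDet_mem_degreeLT hP (n + 1) m)
  rw [opProd_factorOp_eq_act P Q S f L hmem, list_prod_eq_pairProd Q _ hL h,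
    alpha_eq_act hP hQ m S f le_rfl, hF, map_smul, zpow_neg, zpow_natCast]
  simp only [Pi.smul_apply, smul_eq_mul]
  ring

theorem alpha_eq_opProd_pVandermonde (hP : P ≠ 0) (hQ : Q ≠ 0) {n : ℕ} (S : Finset (ℤ × ℤ))
    (f : S → K) {L : List (Fin (n + 1) × Fin (n + 1))} (hL : L.Nodup)
    (h : ∀ p, p ∈ L ↔ p.1 < p.2) (hn : ∀ d : ℕ, 0 < d → d < n + 1 → P ^ d ≠ 1)
    (k : Fin (n + 1) → ℤ) :
    alpha P Q 0 S f (n + 1) k = P ^ (n + 2).choose 3 * Q ^ (-((n + 1).choose 2 : ℤ)) *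
      opProd (factorOp P Q S f) L (pVandermonde P (n + 1)) k := by
  rw [alpha_eq_opProd hP hQ 0 S f hL h (pow_ne_zero _ hP)
      (funext (binomDet_eq_pVandermonde hP hn)), zero_mul, add_zero, ← pow_add, add_comm,
    ← Nat.choose_succ_succ' (n + 1) 2]

theorem alpha_one_eq_opProd_vandermonde (hQ : Q ≠ 0) {n : ℕ} (S : Finset (ℤ × ℤ)) (f : S → K)
    {L : List (Fin (n + 1) × Fin (n + 1))} (hL : L.Nodup) (h : ∀ p, p ∈ L ↔ p.1 < p.2)
    (hn : ∀ d : ℕ, 0 < d → d < n + 1 → (d : K) ≠ 0) (k : Fin (n + 1) → ℤ) :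
    alpha 1 Q 0 S f (n + 1) k = Q ^ (-((n + 1).choose 2 : ℤ)) *
      opProd (factorOp 1 Q S f) L (vandermonde K (n + 1)) k := by
  rw [alpha_eq_opProd one_ne_zero hQ 0 S f hL h one_ne_zero
      ((funext (binomDet_one_eq_vandermonde hn)).trans (one_smul K _).symm), one_pow, one_mul,
    one_mul]

theorem exponent_eq (n m : ℕ) :
    ((((n + 1 : ℕ) : ℤ) - 1) * (((n + 1 : ℕ) : ℤ) ^ 2 - 2 * ((n + 1 : ℕ) : ℤ) + 6 * m)) / 6
      = ((n + 1).choose 3 + m * n : ℕ) := by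
  have hdesc : ((3 * 2 * (n + 1).choose 3 : ℕ) : ℤ)
      = ∏ j ∈ Finset.range 3, (((n + 1 : ℕ) : ℤ) - j) := by
    rw [← descPochhammer_eval_eq_prod_range, descPochhammer_eval_eq_descFactorial,
      Nat.descFactorial_eq_factorial_mul_choose]
    rfl
  simp only [Finset.prod_range_succ, Finset.prod_range_zero] at hdesc
  refine Int.ediv_eq_of_eq_mul_right (by norm_num) ?_
  push_cast at hdesc ⊢
  linear_combination - hdesc

theorem factorOp_one_one {ι : Type*} [DecidableEq ι] :
    factorOp (1 : K) 1 {((0 : ℤ), (0 : ℤ))} (fun _ => -1)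
      = fun (s t : ι) F => F - shift s F + shift s (shift t F) := by
  ext s t F k
  rw [factorOp, laurentOp_singleton_zero]
  simp only [pqShift, pqId, pShift, pDelta, shift, one_zpow, one_smul, one_mul, neg_smul,
    Pi.add_apply, Pi.sub_apply, Pi.neg_apply]
  ring

end Conclusion

end OperatorFormula

end

theorem theorem3_general {K : Type*} [Field K] (P Q : K) (hP : P ≠ 0) (hQ : Q ≠ 0)
    (n m : ℕ) (hn : 0 < n) (S : Finset (ℤ × ℤ)) (f : S → K) :
    (∀ s : Fin n, ∃ r : ℕ,
      (OperatorFormula.pDelta P s)^[r] (OperatorFormula.alpha P Q m S f n) = 0) ∧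
    (∀ L : List (Fin n × Fin n), L.Nodup → (∀ p, p ∈ L ↔ p.1 < p.2) →
      (∀ k : Fin n → ℤ, OperatorFormula.alpha P Q m S f n k =
        P ^ ((((n : ℤ) - 1) * ((n : ℤ) ^ 2 - 2 * n + 6 * m)) / 6) * Q ^ (-(n.choose 2 : ℤ)) *
          OperatorFormula.opProd (OperatorFormula.factorOp P Q S f) L
            (OperatorFormula.binomDet P n m) k) ∧
      ((∀ d : ℕ, 0 < d → d < n → P ^ d ≠ 1) →
        ∀ k : Fin n → ℤ, OperatorFormula.alpha P Q 0 S f n k =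
          P ^ ((n + 1).choose 3) * Q ^ (-(n.choose 2 : ℤ)) *
            OperatorFormula.opProd (OperatorFormula.factorOp P Q S f) L
              (OperatorFormula.pVandermonde P n) k) ∧
      ((∀ d : ℕ, 0 < d → d < n → (d : K) ≠ 0) →
        (∀ k : Fin n → ℤ, OperatorFormula.alpha 1 Q 0 S f n k =
          Q ^ (-(n.choose 2 : ℤ)) *
            OperatorFormula.opProd (OperatorFormula.factorOp 1 Q S f) L
              (OperatorFormula.vandermonde K n) k) ∧
        (∀ k : Fin n → ℤ,
          OperatorFormula.alpha (1 : K) 1 0 {((0 : ℤ), (0 : ℤ))} (fun _ => -1) n k =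
            OperatorFormula.opProd
              (fun s t F => F - OperatorFormula.shift s F
                + OperatorFormula.shift s (OperatorFormula.shift t F)) L
              (OperatorFormula.vandermonde K n) k))) ∧
    (∀ k : Fin n → ℤ, StrictMono k →
      (Nat.card {a // OperatorFormula.IsMonotoneTriangle k a} : K) =
        OperatorFormula.alpha (1 : K) 1 0 {((0 : ℤ), (0 : ℤ))} (fun _ => -1) n k) := by
  obtain ⟨n, rfl⟩ : ∃ n', n = n' + 1 := ⟨n - 1, by omega⟩
  refine ⟨fun s => ⟨_, OperatorFormula.pDelta_iterate_alpha_eq_zero hP hQ m S f s⟩,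
    fun L hL h => ⟨fun k => ?_, fun hd => ?_, fun hd => ⟨?_, fun k => ?_⟩⟩,
    fun k hk => OperatorFormula.card_monotoneTriangle_eq_alpha hk⟩
  · rw [OperatorFormula.exponent_eq, zpow_natCast, OperatorFormula.alpha_eq_opProd hP hQ m S f hL h
      one_ne_zero (one_smul K _).symm, mul_one]
  · exact OperatorFormula.alpha_eq_opProd_pVandermonde hP hQ S f hL h hd
  · exact OperatorFormula.alpha_one_eq_opProd_vandermonde hQ S f hL h hd
  · rw [OperatorFormula.alpha_one_eq_opProd_vandermonde one_ne_zero _ _ hL h hd, one_zpow, one_mul,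
      OperatorFormula.factorOp_one_one]

theorem theorem3 {K : Type*} [Field K] [CharZero K] (P Q : K) (hP : P ≠ 0) (hQ : Q ≠ 0)
    (n m : ℕ) (hn : 0 < n) (S : Finset (ℤ × ℤ)) (f : S → K) :
    -- all inverse shifts in the recursion are applied to functions for which their sum is finite
    (∀ s : Fin n, ∃ r : ℕ,
      (OperatorFormula.pDelta P s)^[r] (OperatorFormula.alpha P Q m S f n) = 0) ∧
    -- `L` lists the pairs `s < t`, in any order
    (∀ L : List (Fin n × Fin n), L.Nodup → (∀ p, p ∈ L ↔ p.1 < p.2) →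
      (∀ k : Fin n → ℤ, OperatorFormula.alpha P Q m S f n k =
        P ^ ((((n : ℤ) - 1) * ((n : ℤ) ^ 2 - 2 * n + 6 * m)) / 6) * Q ^ (-(n.choose 2 : ℤ)) *
          OperatorFormula.opProd (OperatorFormula.factorOp P Q S f) L
            (OperatorFormula.binomDet P n m) k) ∧
      ((∀ d : ℕ, 0 < d → d < n → P ^ d ≠ 1) →
        ∀ k : Fin n → ℤ, OperatorFormula.alpha P Q 0 S f n k =
          P ^ ((n + 1).choose 3) * Q ^ (-(n.choose 2 : ℤ)) *
            OperatorFormula.opProd (OperatorFormula.factorOp P Q S f) L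
              (OperatorFormula.pVandermonde P n) k) ∧
      (∀ k : Fin n → ℤ, OperatorFormula.alpha 1 Q 0 S f n k =
        Q ^ (-(n.choose 2 : ℤ)) *
          OperatorFormula.opProd (OperatorFormula.factorOp 1 Q S f) L
            (OperatorFormula.vandermonde K n) k) ∧
      (∀ k : Fin n → ℤ,
        OperatorFormula.alpha (1 : K) 1 0 {((0 : ℤ), (0 : ℤ))} (fun _ => -1) n k =
          OperatorFormula.opProd
            (fun s t F => F - OperatorFormula.shift s F
              + OperatorFormula.shift s (OperatorFormula.shift t F)) L
            (OperatorFormula.vandermonde K n) k)) ∧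
    (∀ k : Fin n → ℤ, StrictMono k →
      (Nat.card {a // OperatorFormula.IsMonotoneTriangle k a} : K) =
        OperatorFormula.alpha (1 : K) 1 0 {((0 : ℤ), (0 : ℤ))} (fun _ => -1) n k) := by
  obtain ⟨h1, h2, h3⟩ := theorem3_general P Q hP hQ n m hn S f
  exact ⟨h1, fun L hL h => (h2 L hL h).imp_right (And.imp_right
    fun hvandermonde => hvandermonde fun d hd _ => Nat.cast_ne_zero.2 hd.ne'), h3⟩
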